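/- Fix $n\ge 0$ pairwise different observations $w_1,\dots,w_n$. For causes $z_1,\dots,z_j$ with prior parameters $\alpha(z_k)>0$ and probabilities $\beta(w_i|z_k)>0$, $\sum_{i=1}^n\beta(w_i|z_k)\le 1$, let $$\mathbb E[\theta(z)\mid w_1,\dots,w_n]=\frac{\int_{\Delta}\theta(z)\,\theta^{\alpha-1}\prod_{i=1}^n\sum_{k=1}^{j}\beta(w_i|z_k)\theta(z_k)\,d\theta}{\int_{\Delta}\theta^{\alpha-1}\prod_{i=1}^n\sum_{k=1}^{j}\beta(w_i|z_k)\theta(z_k)\,d\theta},\qquad \Delta=\Big\{\theta\in\mathbb R^j:\theta\ge0,\ \sum_k\theta(z_k)=1\Big\},$$ be the posterior mean of the weight of the cause $z$ under a Dirichlet prior with parameters $\alpha(z_1),\dots,\alpha(z_j)$. Consider a deterministic algorithm whose memory consists of $s$ real numbers, with a fixed initial content. It goes once through $m$ causes $z_1,\dots,z_m$. When it reads in $z_j$, i.e. the $n+1$ numbers $\alpha(z_j),\beta(w_1|z_j),\dots,\beta(w_n|z_j)$, it executes a loop-free program (which may depend on $j$) made of finitely many instructions of the following kinds, each reading numbers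 from memory or from the data of the current cause: storing in a memory cell the value of a function $\mathbb R^k\to\mathbb R$, which is Lipschitz continuous or, more generally, locally Lipschitz on a set of arguments outside of which it is never applied; an "if" that tests whether a number is $\le 0$; and the output of a number. Only the memory is carried over to the next cause. The time of an instruction is the number of operands that it reads, and at least $1$. Suppose that, for all admissible data and all $j\le m$, the (last) number that is output after reading $z_j$ is exactly the value that $\mathbb E[\theta(z_j)\mid w_1,\dots,w_n]$ would have if $z_1,\dots,z_j$ were all the causes. If $m\ge 2^n$, then the algorithm needs space of order at least $2^n$ and worst-case time of order at least $m\cdot 2^n$; precisely, $s\ge 2^n-1$, and for some admissible data the total time for the $m$ causes is at least $\tfrac12\,m\,(2^n-1)$. -/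

import Mathlib

/-! ### The Bayesian estimate with a Dirichlet prior -/

namespace LDA

/-- Coordinates `(θ₀, …, θ_{k-1})` of the `k`-dimensional simplex in `ℝ^(k+1)`. -/
def simplexChart (k : ℕ) : Set (Fin k → ℝ) :=
  {x | (∀ i, 0 ≤ x i) ∧ ∑ i, x i ≤ 1}

/-- The point `(x₀, …, x_{k-1}, 1 - ∑ xᵢ)` of the simplex with the given coordinates. -/
def simplexPoint {k : ℕ} (x : Fin k → ℝ) : Fin (k + 1) → ℝ :=
  Fin.snoc x (1 - ∑ i, x i)

/-- `B(α) = (∏ Γ(α_z)) / Γ(∑ α_z)`. -/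
noncomputable def multiBeta {m : ℕ} (α : Fin m → ℝ) : ℝ :=
  (∏ z, Real.Gamma (α z)) / Real.Gamma (∑ z, α z)

/-- The density `θ^(α-1) / B(α)` of the Dirichlet distribution. -/
noncomputable def dirichletDensity {m : ℕ} (α θ : Fin m → ℝ) : ℝ :=
  (∏ z, θ z ^ (α z - 1)) / multiBeta α

/-- The likelihood `∏ᵢ ∑_z β(wᵢ|z) θ(z)` of the observations for the mixture `θ`;
`β z i` stands for `β(wᵢ|z)`. -/
def likelihood {n m : ℕ} (β : Fin m → Fin n → ℝ) (θ : Fin m → ℝ) : ℝ :=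
  ∏ i, ∑ z, β z i * θ z

/-- `p(w₁,…,wₙ|α,β)`: the probability of the observations, an integral over the simplex. -/
noncomputable def evidence {n k : ℕ} (α : Fin (k + 1) → ℝ) (β : Fin (k + 1) → Fin n → ℝ) : ℝ :=
  ∫ x in simplexChart k,
    dirichletDensity α (simplexPoint x) * likelihood β (simplexPoint x)

/-- `E[θ(z)|w₁,…,wₙ]`: the posterior mean of the weight of cause `z`. -/
noncomputable def posteriorMean {n k : ℕ} (α : Fin (k + 1) → ℝ) (β : Fin (k + 1) → Fin n → ℝ)
    (z : Fin (k + 1)) : ℝ :=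
  (∫ x in simplexChart k,
    simplexPoint x z * (dirichletDensity α (simplexPoint x) * likelihood β (simplexPoint x))) /
  evidence α β

/-! ### Input data -/

/-- The data of one cause `z`: the pair of `α(z)` and `(β(wᵢ|z))ᵢ`. -/
abbrev CauseData (n : ℕ) : Type := ℝ × (Fin n → ℝ)

/-- Admissible data of a cause: `α(z) > 0`, and positive probabilities `β(wᵢ|z)` of the `n`
different observations. -/
def CauseData.Valid {n : ℕ} (c : CauseData n) : Prop :=
  0 < c.1 ∧ (∀ i, 0 < c.2 i) ∧ ∑ i, c.2 i ≤ 1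

/-- `E[θ(z_j)|w₁,…,wₙ]` when the causes are exactly `z₀,…,z_j`, with data `c 0,…,c j`. -/
noncomputable def lastCauseMean {n : ℕ} (c : ℕ → CauseData n) (j : ℕ) : ℝ :=
  posteriorMean (fun z : Fin (j + 1) => (c z).1) (fun z : Fin (j + 1) => (c z).2) (Fin.last j)

/-! ### One-pass algorithms -/

/-- What an instruction can read: one of the `s` memory cells, or a number belonging to the
cause that is currently read in. -/
inductive Operand (n s : ℕ) : Type
  | mem (r : Fin s)
  | alpha
  | beta (i : Fin n)

/-- The value of an operand, for current cause `c` and memory contents `μ`. -/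
def Operand.value {n s : ℕ} (c : CauseData n) (μ : Fin s → ℝ) : Operand n s → ℝ
  | .mem r => μ r
  | .alpha => c.1
  | .beta i => c.2 i

/-- A loop-free program with finitely many `if` statements, working on `s` real memory cells.

* `assign t k args dom f hf next` stores `f (args)` in cell `t`. The function `f` of `k` real
  variables is locally Lipschitz on a set `dom` and may only be applied to arguments in `dom`.
  This comprises every Lipschitz function (with `dom` the whole space), multiplication, and
  division away from denominator `0`.
* `branch a p q` is `if a ≤ 0 then p else q`.
* `emit a next` outputs the number `a`.
* `halt` ends the program. -/
inductive Program (n s : ℕ) : Type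
  | halt
  | assign (t : Fin s) (k : ℕ) (args : Fin k → Operand n s) (dom : Set (Fin k → ℝ))
      (f : (Fin k → ℝ) → ℝ) (hf : LocallyLipschitzOn dom f) (next : Program n s)
  | branch (a : Operand n s) (p q : Program n s)
  | emit (a : Operand n s) (next : Program n s)

namespace Program

variable {n s : ℕ}

/-- The memory contents at the end of the program. -/
noncomputable def finalMem (c : CauseData n) : Program n s → (Fin s → ℝ) → (Fin s → ℝ)
  | halt, μ => μ
  | assign t _ args _ f _ next, μ =>
      finalMem c next (Function.update μ t (f fun l => (args l).value c μ))
  | branch a p q, μ => if a.value c μ ≤ 0 then finalMem c p μ else finalMem c q μ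
  | emit _ next, μ => finalMem c next μ

/-- The list of numbers that the program outputs. -/
noncomputable def outputs (c : CauseData n) : Program n s → (Fin s → ℝ) → List ℝ
  | halt, _ => []
  | assign t _ args _ f _ next, μ =>
      outputs c next (Function.update μ t (f fun l => (args l).value c μ))
  | branch a p q, μ => if a.value c μ ≤ 0 then outputs c p μ else outputs c q μ
  | emit a next, μ => a.value c μ :: outputs c next μ

/-- The running time: each executed instruction costs the number of operands that it reads, and
at least one unit. -/
noncomputable def time (c : CauseData n) : Program n s → (Fin s → ℝ) → ℕ
  | halt, _ => 0
  | assign t k args _ f _ next, μ =>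
      max 1 k + time c next (Function.update μ t (f fun l => (args l).value c μ))
  | branch a p q, μ => 1 + if a.value c μ ≤ 0 then time c p μ else time c q μ
  | emit _ next, μ => 1 + time c next μ

/-- All functions that are applied in the execution are applied inside their domains. -/
def Safe (c : CauseData n) : Program n s → (Fin s → ℝ) → Prop
  | halt, _ => True
  | assign t _ args dom f _ next, μ =>
      (fun l => (args l).value c μ) ∈ dom ∧
        Safe c next (Function.update μ t (f fun l => (args l).value c μ))
  | branch a p q, μ => (a.value c μ ≤ 0 → Safe c p μ) ∧ (¬ a.value c μ ≤ 0 → Safe c q μ)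
  | emit _ next, μ => Safe c next μ

end Program

/-- A one-pass algorithm using `s` real memory cells: initial memory contents (not depending on
the data) and, for each `j`, the program that is executed when cause `z_j` is read in. Only the
memory cells are carried over from one cause to the next. -/
structure OnePassAlgorithm (n s : ℕ) where
  init : Fin s → ℝ
  program : ℕ → Program n s

namespace OnePassAlgorithm

variable {n s : ℕ}

/-- The memory contents just before cause `z_j` is read in. -/
noncomputable def memory (A : OnePassAlgorithm n s) (c : ℕ → CauseData n) : ℕ → (Fin s → ℝ)
  | 0 => A.init
  | j + 1 => (A.program j).finalMem (c j) (A.memory c j)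

/-- The time used for processing the first `m` causes. -/
noncomputable def time (A : OnePassAlgorithm n s) (c : ℕ → CauseData n) (m : ℕ) : ℕ :=
  ∑ j ∈ Finset.range m, (A.program j).time (c j) (A.memory c j)

/-- For all admissible data of `m` causes, after reading each cause `z_j` the algorithm outputs
the value that `E[θ(z_j)|w₁,…,wₙ]` would have if `z_j` was the last cause. It may output other
numbers before this one, for instance the expectations for the earlier causes. -/
def ComputesPosteriorMean (A : OnePassAlgorithm n s) (m : ℕ) : Prop :=
  ∀ c : ℕ → CauseData n, (∀ j, (c j).Valid) → ∀ j < m,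
    (A.program j).Safe (c j) (A.memory c j) ∧
      ((A.program j).outputs (c j) (A.memory c j)).getLast? = some (lastCauseMean c j)

end OnePassAlgorithm

end LDA

/-! In closed form (`lastCauseMean_eq`) the posterior mean of `z_j`, with data `(a, b)`, is `a N /
((A + a + n) M)`. Here `A` is the sum of the earlier prior parameters, and `N`, `M` are multi-affine
polynomials in `b`. Up to positive rising factorials their coefficients are the numbers `G W`, the
total weight of all assignments of earlier causes to the observations in `W`. As `G ∅ = 1`, the pair
`(A, G)` has `2 ^ n` free parameters, and the memory has to carry them.

To see this, vary the prior parameters of the first `e ≤ min j (2 ^ n)` causes, with the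
probabilities fixed such that the vectors `(∏_{i ∈ V} β(wᵢ|z))_V` are linearly independent. For
subset convolution, each cause contributes the exponential of `α(z)` times `logWeight`, so a
velocity `v` changes `G` at first order by the convolution of `G` with `κ = ∑ v_z logWeight (β z)`.
If no posterior mean changes at first order for `b` in an open set, then `A` and `G` do not change
either (`eq_zero_of_variation_eq_zero`); hence `κ = 0`, and `v = 0` by independence. So there are
`e` values of `b` for which the vector of the `e` posterior means fills a neighbourhood and has
Hausdorff dimension `e` (`exists_dimH_image_meanAt`).

On the other hand, on a small open box of data every `if` is decided in the same way, and the output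
for `z_j` is a locally Lipschitz function of the current cause and of the cells in a fixed set `R`,
whose size is at most the time spent on `z_j` (`exists_dataBox`). The memory does not know which of
the `e` values of `b` comes next, and locally Lipschitz maps do not raise Hausdorff dimension; so `e
≤ R.card` (`le_card_of_factors`). This bounds the space, and the sum over `j` bounds the time. -/

section LocallyLipschitz

/-! ### Locally Lipschitz functions on sets -/

variable {α β γ : Type*} [PseudoEMetricSpace α] [PseudoEMetricSpace β] [PseudoEMetricSpace γ]

theorem LocallyLipschitzOn.comp' {g : β → γ} {f : α → β} {s : Set α} {t : Set β}
    (hg : LocallyLipschitzOn t g) (hf : LocallyLipschitzOn s f) (h : Set.MapsTo f s t) :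
    LocallyLipschitzOn s fun x => g (f x) := fun x hx => by
  obtain ⟨Kf, u, hu, hfu⟩ := hf hx
  obtain ⟨Kg, w, hw, hgw⟩ := hg (h hx)
  have hc := (hf.continuousOn x hx).tendsto_nhdsWithin h
  exact ⟨Kg * Kf, u ∩ f ⁻¹' w, Filter.inter_mem hu (hc hw),
    hgw.comp (hfu.mono Set.inter_subset_left) fun _ hy => hy.2⟩

theorem LocallyLipschitzOn.prodMk' {f : α → β} {g : α → γ} {s : Set α}
    (hf : LocallyLipschitzOn s f) (hg : LocallyLipschitzOn s g) :
    LocallyLipschitzOn s fun x => (f x, g x) := fun x hx => by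
  obtain ⟨K, u, hu, hfu⟩ := hf hx
  obtain ⟨L, w, hw, hgw⟩ := hg hx
  refine ⟨max K L, u ∩ w, Filter.inter_mem hu hw, fun y hy z hz => ?_⟩
  rw [Prod.edist_eq]
  exact max_le ((hfu hy.1 hz.1).trans (mul_le_mul_left (by simp) _))
    ((hgw hy.2 hz.2).trans (mul_le_mul_left (by simp) _))

theorem locallyLipschitzOn_pi {ι : Type*} [Fintype ι] {f : α → ι → β} {s : Set α}
    (hf : ∀ i, LocallyLipschitzOn s fun x => f x i) : LocallyLipschitzOn s f := fun x hx => by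
  choose K u hu hfu using fun i => hf i hx
  refine ⟨Finset.univ.sup K, ⋂ i, u i, (Filter.iInter_mem).2 hu, fun y hy z hz => ?_⟩
  rw [edist_pi_le_iff]
  intro i
  refine (hfu i (Set.mem_iInter.1 hy i) (Set.mem_iInter.1 hz i)).trans (mul_le_mul_left ?_ _)
  exact_mod_cast Finset.le_sup (f := K) (Finset.mem_univ i)

end LocallyLipschitz

open MeasureTheory
open scoped Topology

namespace LDA

variable {n : ℕ}

/-! ### The Dirichlet integral -/

theorem multiBeta_pos {m : ℕ} {α : Fin (m + 1) → ℝ} (hα : ∀ z, 0 < α z) : 0 < multiBeta α :=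
  div_pos (Finset.prod_pos fun z _ => Real.Gamma_pos_of_pos (hα z))
    (Real.Gamma_pos_of_pos (Finset.sum_pos (fun z _ => hα z) Finset.univ_nonempty))

theorem measurableSet_simplexChart (k : ℕ) : MeasurableSet (simplexChart k) := by
  apply IsClosed.measurableSet
  have : simplexChart k = (⋂ i, {x : Fin k → ℝ | 0 ≤ x i}) ∩ {x | ∑ i, x i ≤ 1} := by
    ext x; simp [simplexChart]
  rw [this]
  exact (isClosed_iInter fun i => isClosed_le continuous_const (continuous_apply i)).inter
    (isClosed_le (by fun_prop) continuous_const)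

theorem measurable_simplexPoint (k : ℕ) :
    Measurable (simplexPoint : (Fin k → ℝ) → (Fin (k + 1) → ℝ)) := by
  refine measurable_pi_lambda _ fun z => ?_
  refine Fin.lastCases ?_ (fun i => ?_) z
  · simp only [simplexPoint, Fin.snoc_last]; fun_prop
  · simp only [simplexPoint, Fin.snoc_castSucc]; fun_prop

theorem simplexPoint_nonneg {k : ℕ} {x : Fin k → ℝ} (hx : x ∈ simplexChart k) (z : Fin (k + 1)) :
    0 ≤ simplexPoint x z := by
  refine Fin.lastCases ?_ (fun i => ?_) z
  · simp only [simplexPoint, Fin.snoc_last]; linarith [hx.2]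
  · simp only [simplexPoint, Fin.snoc_castSucc]; exact hx.1 i

/-- Splitting off the first weight `t` leaves a copy of the smaller simplex, scaled by `1 - t`; the
Dirichlet integral is computed by induction along this splitting. -/
theorem simplexPoint_cons {k : ℕ} (t : ℝ) (x : Fin k → ℝ) :
    simplexPoint (Fin.cons t ((1 - t) • x) : Fin (k + 1) → ℝ) =
      Fin.cons t ((1 - t) • simplexPoint x) := by
  have h : (1 - t) • simplexPoint x =
      (Fin.snoc ((1 - t) • x) ((1 - t) * (1 - ∑ i, x i)) : Fin (k + 1) → ℝ) := by
    funext z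
    refine Fin.lastCases ?_ (fun i => ?_) z <;> simp [simplexPoint]
  rw [h, Fin.cons_snoc_eq_snoc_cons, simplexPoint]
  congr 1
  simp only [Fin.sum_univ_succ, Fin.cons_zero, Fin.cons_succ, Pi.smul_apply, smul_eq_mul,
    ← Finset.mul_sum]
  ring

theorem cons_mem_simplexChart {k : ℕ} {t : ℝ} (h0 : 0 < t) (h1 : t < 1) (x : Fin k → ℝ) :
    (Fin.cons t ((1 - t) • x) : Fin (k + 1) → ℝ) ∈ simplexChart (k + 1) ↔ x ∈ simplexChart k := by
  have ht : 0 < 1 - t := by linarith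
  simp only [simplexChart, Set.mem_ofPred_eq, Fin.forall_fin_succ, Fin.sum_univ_succ, Fin.cons_zero,
    Fin.cons_succ, Pi.smul_apply, smul_eq_mul, ← Finset.mul_sum]
  constructor
  · rintro ⟨⟨-, h⟩, h'⟩
    exact ⟨fun i => nonneg_of_mul_nonneg_right (h i) ht, by nlinarith⟩
  · rintro ⟨h, h'⟩
    exact ⟨⟨h0.le, fun i => mul_nonneg ht.le (h i)⟩, by nlinarith⟩

/-- The unnormalised Dirichlet density on the simplex, as an extended nonnegative function that
vanishes outside the simplex. -/
noncomputable def dirichletKernel {k : ℕ} (α : Fin (k + 1) → ℝ) (x : Fin k → ℝ) : ENNReal :=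
  (simplexChart k).indicator
    (fun x => ENNReal.ofReal (∏ z, simplexPoint x z ^ (α z - 1))) x

theorem measurable_prod_rpow {k : ℕ} (α : Fin (k + 1) → ℝ) :
    Measurable fun x : Fin k → ℝ => ∏ z, simplexPoint x z ^ (α z - 1) := by
  have h := measurable_simplexPoint k
  exact Finset.measurable_prod _ fun z _ => ((measurable_pi_apply z).comp h).pow_const _

theorem measurable_dirichletKernel {k : ℕ} (α : Fin (k + 1) → ℝ) :
    Measurable (dirichletKernel α) :=
  (measurable_prod_rpow α).ennreal_ofReal.indicator (measurableSet_simplexChart k)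

theorem dirichletKernel_cons {k : ℕ} (α : Fin (k + 2) → ℝ) {t : ℝ} (h0 : 0 < t) (h1 : t < 1)
    (x : Fin k → ℝ) :
    dirichletKernel α (Fin.cons t ((1 - t) • x)) =
      ENNReal.ofReal (t ^ (α 0 - 1) * (1 - t) ^ ((∑ z, α (Fin.succ z)) - (k + 1 : ℕ))) *
        dirichletKernel (fun z => α (Fin.succ z)) x := by
  have ht : 0 < 1 - t := by linarith
  by_cases hx : x ∈ simplexChart k
  · rw [dirichletKernel, dirichletKernel, Set.indicator_of_mem hx,
      Set.indicator_of_mem ((cons_mem_simplexChart h0 h1 x).2 hx),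
      ← ENNReal.ofReal_mul (by positivity), simplexPoint_cons, Fin.prod_univ_succ]
    simp only [Fin.cons_zero, Fin.cons_succ, Pi.smul_apply, smul_eq_mul]
    rw [Finset.prod_congr rfl fun z _ => Real.mul_rpow ht.le (simplexPoint_nonneg hx z),
      Finset.prod_mul_distrib, ← Real.rpow_sum_of_pos ht]
    simp [Finset.sum_sub_distrib, mul_assoc]
  · rw [dirichletKernel, dirichletKernel, Set.indicator_of_notMem hx,
      Set.indicator_of_notMem (mt (cons_mem_simplexChart h0 h1 x).1 hx), mul_zero]

theorem lintegral_eq_mul_lintegral_comp_smul {k : ℕ} (f : (Fin k → ℝ) → ENNReal)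
    {r : ℝ} (hr : 0 < r) :
    ∫⁻ x, f x = ENNReal.ofReal (r ^ k) * ∫⁻ x, f (r • x) := by
  have h := Measure.map_addHaar_smul (volume : Measure (Fin k → ℝ)) hr.ne'
  have e : MeasurableEmbedding (fun x : Fin k → ℝ => r • x) :=
    (Homeomorph.smulOfNeZero r hr.ne').measurableEmbedding
  rw [← e.lintegral_map, show (fun x : Fin k → ℝ => r • x) = (r • ·) from rfl, h,
    lintegral_smul_measure, smul_eq_mul, ← mul_assoc, ← ENNReal.ofReal_mul (by positivity)]
  rw [Module.finrank_fin_fun, abs_of_pos (by positivity), mul_inv_cancel₀ (by positivity)]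
  simp

/-- The Jacobian `(1 - t) ^ k` of the scaling raises the exponent of `1 - t` in
`dirichletKernel_cons` from `∑ α - (k + 1)` to `∑ α - 1`, which makes the integral over `t` a beta
integral. -/
theorem lintegral_dirichletKernel_cons {k : ℕ} (α : Fin (k + 2) → ℝ) {t : ℝ} (h0 : 0 < t)
    (h1 : t < 1) :
    ∫⁻ x, dirichletKernel α (Fin.cons t x) =
      ENNReal.ofReal (t ^ (α 0 - 1) * (1 - t) ^ ((∑ z, α (Fin.succ z)) - 1)) *
        ∫⁻ x, dirichletKernel (fun z => α (Fin.succ z)) x := by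
  have ht : 0 < 1 - t := by linarith
  rw [lintegral_eq_mul_lintegral_comp_smul _ ht]
  simp only [dirichletKernel_cons α h0 h1]
  rw [lintegral_const_mul _ (measurable_dirichletKernel _), ← mul_assoc,
    ← ENNReal.ofReal_mul (by positivity)]
  congr 2
  rw [mul_left_comm, ← Real.rpow_natCast, ← Real.rpow_add ht]
  congr 2
  push_cast
  ring

theorem lintegral_beta {a b : ℝ} (ha : 0 < a) (hb : 0 < b) :
    ∫⁻ t in Set.Ioo (0 : ℝ) 1, ENNReal.ofReal (t ^ (a - 1) * (1 - t) ^ (b - 1)) =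
      ENNReal.ofReal (ProbabilityTheory.beta a b) := by
  have h := ProbabilityTheory.lintegral_betaPDF_eq_one ha hb
  have hB := ProbabilityTheory.beta_pos ha hb
  rw [ProbabilityTheory.lintegral_betaPDF] at h
  have h2 : ∀ x : ℝ, ENNReal.ofReal (1 / ProbabilityTheory.beta a b * x ^ (a - 1) *
      (1 - x) ^ (b - 1)) = ENNReal.ofReal (1 / ProbabilityTheory.beta a b) *
        ENNReal.ofReal (x ^ (a - 1) * (1 - x) ^ (b - 1)) := fun x => by
    rw [← ENNReal.ofReal_mul (by positivity), mul_assoc]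
  simp only [h2] at h
  rw [lintegral_const_mul _ (by fun_prop)] at h
  rw [← mul_one (ENNReal.ofReal (ProbabilityTheory.beta a b)), ← h, ← mul_assoc,
    ← ENNReal.ofReal_mul hB.le, mul_one_div_cancel hB.ne', ENNReal.ofReal_one, one_mul]

theorem multiBeta_succ {k : ℕ} (α : Fin (k + 2) → ℝ) (hα : ∀ z, 0 < α z) :
    multiBeta α = ProbabilityTheory.beta (α 0) (∑ z, α (Fin.succ z)) *
      multiBeta (fun z => α (Fin.succ z)) := by
  have : 0 < ∑ z : Fin (k + 1), α (Fin.succ z) :=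
    Finset.sum_pos (fun z _ => hα _) Finset.univ_nonempty
  have := (Real.Gamma_pos_of_pos this).ne'
  rw [multiBeta, multiBeta, ProbabilityTheory.beta, Fin.prod_univ_succ, Fin.sum_univ_succ]
  field_simp

/-- The Dirichlet integral. -/
theorem lintegral_dirichletKernel : ∀ {k : ℕ} (α : Fin (k + 1) → ℝ), (∀ z, 0 < α z) →
    ∫⁻ x, dirichletKernel α x = ENNReal.ofReal (multiBeta α)
  | 0, α, hα => by
    have h1 : Real.Gamma (α 0) ≠ 0 := (Real.Gamma_pos_of_pos (hα 0)).ne'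
    have : dirichletKernel α = fun _ => 1 := by
      funext x
      rw [dirichletKernel, Set.indicator_of_mem]
      · have : simplexPoint x 0 = 1 := by
          rw [show (0 : Fin 1) = Fin.last 0 from rfl, simplexPoint, Fin.snoc_last]; simp
        simp [this]
      · simp [simplexChart]
    rw [this]
    simp [multiBeta, h1, volume_pi]
  | k + 1, α, hα => by
    have ih := lintegral_dirichletKernel (fun z => α (Fin.succ z)) fun z => hα _
    have hs : 0 < ∑ z : Fin (k + 1), α (Fin.succ z) :=
      Finset.sum_pos (fun z _ => hα _) Finset.univ_nonempty
    have e := volume_preserving_piFinSuccAbove (fun _ : Fin (k + 1) => ℝ) 0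
    have hsymm : ∀ p : ℝ × (Fin k → ℝ),
        (MeasurableEquiv.piFinSuccAbove (fun _ : Fin (k + 1) => ℝ) 0).symm p =
          Fin.cons p.1 p.2 := fun p => by
      simp [MeasurableEquiv.piFinSuccAbove, Fin.insertNthEquiv]
    have hm : Measurable fun p : ℝ × (Fin k → ℝ) =>
        dirichletKernel α ((MeasurableEquiv.piFinSuccAbove (fun _ : Fin (k + 1) => ℝ) 0).symm p) :=
      (measurable_dirichletKernel α).comp (MeasurableEquiv.measurable _)
    rw [← (e.symm _).lintegral_comp_emb (MeasurableEquiv.measurableEmbedding _),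
      Measure.volume_eq_prod, lintegral_prod _ hm.aemeasurable]
    simp only [hsymm]
    -- Slices at `t < 0` or `t > 1` miss the simplex, and the two endpoints are negligible.
    have hae : ∀ᵐ t : ℝ, ∫⁻ y, dirichletKernel α (Fin.cons t y) =
        (Set.Ioo (0 : ℝ) 1).indicator (fun t => ENNReal.ofReal
          (t ^ (α 0 - 1) * (1 - t) ^ ((∑ z, α (Fin.succ z)) - 1)) *
          ∫⁻ x, dirichletKernel (fun z => α (Fin.succ z)) x) t := by
      filter_upwards [Measure.ae_ne volume (0 : ℝ), Measure.ae_ne volume (1 : ℝ)] with t h0 h1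
      by_cases ht : t ∈ Set.Ioo (0 : ℝ) 1
      · rw [Set.indicator_of_mem ht, lintegral_dirichletKernel_cons α ht.1 ht.2]
      · rw [Set.indicator_of_notMem ht]
        have : ∀ y : Fin k → ℝ, dirichletKernel α (Fin.cons t y : Fin (k + 1) → ℝ) = 0 := fun y => by
          rw [dirichletKernel, Set.indicator_of_notMem]
          rintro ⟨hp, hle⟩
          have hp0 : 0 ≤ t := hp 0
          have : 0 ≤ ∑ i, y i := Finset.sum_nonneg fun i _ => hp (Fin.succ i)
          simp only [Fin.sum_univ_succ, Fin.cons_zero, Fin.cons_succ] at hle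
          exact ht ⟨lt_of_le_of_ne hp0 (Ne.symm h0), lt_of_le_of_ne (by linarith) h1⟩
        simp [this]
    rw [lintegral_congr_ae hae, lintegral_indicator measurableSet_Ioo,
      lintegral_mul_const _ (by fun_prop), lintegral_beta (hα 0) hs, ih,
      ← ENNReal.ofReal_mul (ProbabilityTheory.beta_pos (hα 0) hs).le, multiBeta_succ α hα]

theorem integrableOn_dirichlet {k : ℕ} {α : Fin (k + 1) → ℝ} (hα : ∀ z, 0 < α z) :
    IntegrableOn (fun x : Fin k → ℝ => ∏ z, simplexPoint x z ^ (α z - 1)) (simplexChart k) := by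
  refine ⟨(measurable_prod_rpow α).aestronglyMeasurable, ?_⟩
  rw [hasFiniteIntegral_iff_ofReal]
  · rw [← lintegral_indicator (measurableSet_simplexChart k)]
    exact (lintegral_dirichletKernel α hα).trans_lt ENNReal.ofReal_lt_top
  · exact ae_restrict_of_forall_mem (measurableSet_simplexChart k) fun x hx =>
      Finset.prod_nonneg fun z _ => Real.rpow_nonneg (simplexPoint_nonneg hx z) _

theorem integral_dirichlet {k : ℕ} {α : Fin (k + 1) → ℝ} (hα : ∀ z, 0 < α z) :
    ∫ x in simplexChart k, ∏ z, simplexPoint x z ^ (α z - 1) = multiBeta α := by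
  rw [integral_eq_lintegral_of_nonneg_ae]
  · rw [← lintegral_indicator (measurableSet_simplexChart k)]
    exact (congrArg ENNReal.toReal (lintegral_dirichletKernel α hα)).trans
      (ENNReal.toReal_ofReal (multiBeta_pos hα).le)
  · exact ae_restrict_of_forall_mem (measurableSet_simplexChart k) fun x hx =>
      Finset.prod_nonneg fun z _ => Real.rpow_nonneg (simplexPoint_nonneg hx z) _
  · exact (measurable_prod_rpow α).aestronglyMeasurable

/-! ### The posterior mean in closed form -/

/-- Subset convolution of two set functions. -/
def subsetConv (f g : Finset (Fin n) → ℝ) (W : Finset (Fin n)) : ℝ :=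
  ∑ V ∈ W.powerset, f (W \ V) * g V

/-- The product of `∏_{i ∈ V} β(wᵢ|z)` and the rising factorial of `α(z)` of order `|V|`. -/
def causeWeight (c : CauseData n) (V : Finset (Fin n)) : ℝ :=
  (∏ l ∈ Finset.range V.card, (c.1 + l)) * ∏ i ∈ V, c.2 i

/-- The total weight of all assignments of causes among the first `j` to the observations
in `W`. -/
def assignmentWeight (c : ℕ → CauseData n) : ℕ → Finset (Fin n) → ℝ
  | 0, W => if W = ∅ then 1 else 0
  | j + 1, W => subsetConv (assignmentWeight c j) (causeWeight (c j)) W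

theorem assignmentWeight_congr {c c' : ℕ → CauseData n} : ∀ {j : ℕ}, (∀ z < j, c z = c' z) →
    assignmentWeight c j = assignmentWeight c' j
  | 0, _ => rfl
  | j + 1, h => by
    funext W
    rw [assignmentWeight, assignmentWeight,
      assignmentWeight_congr fun z hz => h z (hz.trans j.lt_succ_self), h j j.lt_succ_self]

theorem assignmentWeight_empty (c : ℕ → CauseData n) : ∀ j, assignmentWeight c j ∅ = 1
  | 0 => rfl
  | j + 1 => by
    simp [assignmentWeight, subsetConv, causeWeight, assignmentWeight_empty c j]

theorem causeWeight_pos {c : CauseData n} (h1 : 0 < c.1) (h2 : ∀ i, 0 < c.2 i)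
    (V : Finset (Fin n)) : 0 < causeWeight c V :=
  mul_pos (Finset.prod_pos fun l _ => by positivity) (Finset.prod_pos fun i _ => h2 i)

/-- The first factor of the rising factorial is split off: one observation fewer, prior parameter
raised by one. Multiplication of the Dirichlet density by `θ(z)` has the same effect on the
parameter. -/
theorem causeWeight_insert (c : CauseData n) {i : Fin n} {V : Finset (Fin n)} (hi : i ∉ V) :
    causeWeight c (insert i V) = c.2 i * c.1 * causeWeight (c.1 + 1, c.2) V := by
  rw [causeWeight, causeWeight, Finset.card_insert_of_notMem hi, Finset.prod_insert hi,
    Finset.prod_range_succ']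
  have : ∀ l ∈ Finset.range V.card, c.1 + ((l + 1 : ℕ) : ℝ) = c.1 + 1 + l := fun l _ => by
    push_cast; ring
  rw [Finset.prod_congr rfl this]
  push_cast
  ring

theorem assignmentWeight_nonneg {c : ℕ → CauseData n} (h1 : ∀ z, 0 < (c z).1)
    (h2 : ∀ z i, 0 < (c z).2 i) : ∀ j W, 0 ≤ assignmentWeight c j W
  | 0, W => by rw [assignmentWeight]; split_ifs <;> norm_num
  | j + 1, W => Finset.sum_nonneg fun V _ =>
      mul_nonneg (assignmentWeight_nonneg h1 h2 j _) (causeWeight_pos (h1 j) (h2 j) V).le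

theorem subsetConv_pos {c : ℕ → CauseData n} (h1 : ∀ z, 0 < (c z).1)
    (h2 : ∀ z i, 0 < (c z).2 i) (j : ℕ) {d : CauseData n} (h3 : 0 < d.1) (h4 : ∀ i, 0 < d.2 i)
    (W : Finset (Fin n)) : 0 < subsetConv (assignmentWeight c j) (causeWeight d) W := by
  refine Finset.sum_pos' (fun V _ =>
    mul_nonneg (assignmentWeight_nonneg h1 h2 j _) (causeWeight_pos h3 h4 V).le)
    ⟨W, Finset.mem_powerset_self W, ?_⟩
  rw [Finset.sdiff_self, assignmentWeight_empty, one_mul]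
  exact causeWeight_pos h3 h4 W

/-- The terms are sorted by the cause `z` that is assigned to the observation `i`. -/
theorem assignmentWeight_insert {i : Fin n} {W : Finset (Fin n)} (hi : i ∉ W) :
    ∀ (j : ℕ) (c : ℕ → CauseData n), assignmentWeight c j (insert i W) =
      ∑ z ∈ Finset.range j, (c z).2 i * (c z).1 *
        assignmentWeight (Function.update c z ((c z).1 + 1, (c z).2)) j W := by
  intro j
  induction j generalizing W with
  | zero => intro c; simp [assignmentWeight]
  | succ j ih =>
    intro c
    rw [Finset.sum_range_succ, assignmentWeight, subsetConv, Finset.sum_powerset_insert hi]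
    congr 1
    · simp only [assignmentWeight, subsetConv]
      simp only [Finset.mul_sum]
      rw [Finset.sum_comm]
      refine Finset.sum_congr rfl fun V hV => ?_
      have hiV : i ∉ V := fun h => hi (Finset.mem_powerset.1 hV h)
      rw [Finset.insert_sdiff_of_notMem _ hiV, ih (fun h => hi (Finset.mem_sdiff.1 h).1),
        Finset.sum_mul]
      refine Finset.sum_congr rfl fun z hz => ?_
      rw [Function.update_of_ne (Finset.mem_range.1 hz).ne']
      ring
    · rw [assignmentWeight, subsetConv, Finset.mul_sum]
      refine Finset.sum_congr rfl fun V hV => ?_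
      have hiV : i ∉ V := fun h => hi (Finset.mem_powerset.1 hV h)
      rw [causeWeight_insert _ hiV, Function.update_self, Finset.insert_sdiff_insert,
        Finset.sdiff_insert_of_notMem hi,
        assignmentWeight_congr (c := Function.update c j ((c j).1 + 1, (c j).2)) (c' := c)
          fun z hz => Function.update_of_ne hz.ne _ _]
      ring

theorem update_coe_fst {k : ℕ} (c : ℕ → CauseData n) (z₀ z : Fin (k + 1)) :
    (Function.update c z₀ ((c z₀).1 + 1, (c z₀).2) z).1 =
      (c z).1 + if z = z₀ then 1 else 0 := by
  by_cases h : z = z₀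
  · subst h; simp
  · rw [Function.update_of_ne (fun h' => h (Fin.ext h')), if_neg h, add_zero]

theorem update_coe_snd (c : ℕ → CauseData n) (y z : ℕ) (a : ℝ) :
    (Function.update c y (a, (c y).2) z).2 = (c z).2 := by
  by_cases h : z = y
  · subst h; simp
  · rw [Function.update_of_ne h]

theorem rpow_add_one_sub_one {t a : ℝ} (ht : 0 ≤ t) (ha : 0 < a) :
    t ^ (a + 1 - 1) = t * t ^ (a - 1) := by
  rcases ht.eq_or_lt with rfl | ht
  · rw [add_sub_cancel_right, Real.zero_rpow ha.ne', zero_mul]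
  · rw [add_sub_right_comm, Real.rpow_add_one ht.ne', mul_comm]

/-- The weight of `θ` in the Dirichlet integral for the observations in `W`. -/
noncomputable def mixtureIntegrand {k : ℕ} (c : ℕ → CauseData n) (W : Finset (Fin n))
    (x : Fin k → ℝ) : ℝ :=
  (∏ z : Fin (k + 1), simplexPoint x z ^ ((c z).1 - 1)) *
    ∏ i ∈ W, ∑ z : Fin (k + 1), (c z).2 i * simplexPoint x z

theorem prod_rpow_update {k : ℕ} {c : ℕ → CauseData n} (hc : ∀ z, 0 < (c z).1)
    (z₀ : Fin (k + 1)) {x : Fin k → ℝ} (hx : x ∈ simplexChart k) :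
    ∏ z : Fin (k + 1), simplexPoint x z ^
        ((Function.update c z₀ ((c z₀).1 + 1, (c z₀).2) z).1 - 1) =
      simplexPoint x z₀ * ∏ z : Fin (k + 1), simplexPoint x z ^ ((c z).1 - 1) := by
  have h : ∀ z ∈ (Finset.univ : Finset (Fin (k + 1))), simplexPoint x z ^
      ((Function.update c z₀ ((c z₀).1 + 1, (c z₀).2) z).1 - 1) =
      (if z = z₀ then simplexPoint x z else 1) * simplexPoint x z ^ ((c z).1 - 1) := fun z _ => by
    rw [update_coe_fst]
    split_ifs
    · exact rpow_add_one_sub_one (simplexPoint_nonneg hx z) (hc z)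
    · rw [add_zero, one_mul]
  rw [Finset.prod_congr rfl h, Finset.prod_mul_distrib]
  simp

theorem prod_Gamma_update {k : ℕ} {c : ℕ → CauseData n} (hc : ∀ z, 0 < (c z).1)
    (z₀ : Fin (k + 1)) :
    ∏ z : Fin (k + 1), Real.Gamma (Function.update c z₀ ((c z₀).1 + 1, (c z₀).2) z).1 =
      (c z₀).1 * ∏ z : Fin (k + 1), Real.Gamma (c z).1 := by
  have h : ∀ z ∈ (Finset.univ : Finset (Fin (k + 1))),
      Real.Gamma (Function.update c z₀ ((c z₀).1 + 1, (c z₀).2) z).1 =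
      (if z = z₀ then (c z).1 else 1) * Real.Gamma (c z).1 := fun z _ => by
    rw [update_coe_fst]
    split_ifs
    · exact Real.Gamma_add_one (hc z).ne'
    · rw [add_zero, one_mul]
  rw [Finset.prod_congr rfl h, Finset.prod_mul_distrib]
  simp

theorem sum_fst_update {k : ℕ} (c : ℕ → CauseData n) (z₀ : Fin (k + 1)) :
    ∑ z : Fin (k + 1), (Function.update c z₀ ((c z₀).1 + 1, (c z₀).2) z).1 =
      ∑ z : Fin (k + 1), (c z).1 + 1 := by
  simp only [update_coe_fst, Finset.sum_add_distrib]
  simp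

theorem update_fst_pos {c : ℕ → CauseData n} (hc : ∀ z, 0 < (c z).1) (z₀ z : ℕ) :
    0 < (Function.update c z₀ ((c z₀).1 + 1, (c z₀).2) z).1 := by
  by_cases h : z = z₀
  · subst h; simpa using add_pos (hc z) one_pos
  · rw [Function.update_of_ne h]; exact hc z

theorem mixtureIntegrand_insert {k : ℕ} {c : ℕ → CauseData n} (hc : ∀ z, 0 < (c z).1)
    {i : Fin n} {W : Finset (Fin n)} (hi : i ∉ W) {x : Fin k → ℝ} (hx : x ∈ simplexChart k) :
    mixtureIntegrand c (insert i W) x = ∑ z : Fin (k + 1), (c z).2 i *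
      mixtureIntegrand (Function.update c z ((c z).1 + 1, (c z).2)) W x := by
  simp only [mixtureIntegrand, prod_rpow_update hc _ hx, update_coe_snd, Finset.prod_insert hi]
  rw [Finset.sum_mul, Finset.mul_sum]
  exact Finset.sum_congr rfl fun z _ => by ring

/-- Expanding the likelihood factor of one observation trades it for a raised prior parameter, and
`assignmentWeight_insert` is the same recursion on the other side. The induction therefore has to
run over all `c`; it ends at the Dirichlet integral. -/
theorem integral_mixtureIntegrand {k : ℕ} (W : Finset (Fin n)) {c : ℕ → CauseData n}
    (hc : ∀ z, 0 < (c z).1) :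
    IntegrableOn (mixtureIntegrand c W) (simplexChart k) ∧
      ∫ x in simplexChart k, mixtureIntegrand c W x =
        (∏ z : Fin (k + 1), Real.Gamma (c z).1) /
          Real.Gamma (∑ z : Fin (k + 1), (c z).1 + W.card) * assignmentWeight c (k + 1) W := by
  induction W using Finset.induction_on generalizing c with
  | empty =>
    have h := fun z : Fin (k + 1) => hc z
    have e : mixtureIntegrand c ∅ =
        fun x : Fin k → ℝ => ∏ z : Fin (k + 1), simplexPoint x z ^ ((c z).1 - 1) := by
      funext x; simp [mixtureIntegrand]
    rw [e]
    refine ⟨integrableOn_dirichlet h, ?_⟩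
    rw [integral_dirichlet h, assignmentWeight_empty]
    simp [multiBeta]
  | insert i W hi ih =>
    have hS := measurableSet_simplexChart k
    have hu := fun z : Fin (k + 1) => ih (update_fst_pos hc z)
    have hint : ∀ z ∈ (Finset.univ : Finset (Fin (k + 1))), IntegrableOn (fun x => (c z).2 i *
      mixtureIntegrand (Function.update c z ((c z).1 + 1, (c z).2)) W x) (simplexChart k) :=
      fun z _ => (hu z).1.const_mul _
    have hcongr : Set.EqOn (mixtureIntegrand c (insert i W)) (fun x => ∑ z : Fin (k + 1),
        (c z).2 i * mixtureIntegrand (Function.update c z ((c z).1 + 1, (c z).2)) W x)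
        (simplexChart k) := fun x hx => mixtureIntegrand_insert hc hi hx
    refine ⟨(integrableOn_congr_fun hcongr hS).2 (integrable_finsetSum _ hint), ?_⟩
    rw [setIntegral_congr_fun hS hcongr, integral_finsetSum _ hint,
      assignmentWeight_insert hi, ← Fin.sum_univ_eq_sum_range (fun z => (c z).2 i * (c z).1 *
        assignmentWeight (Function.update c z ((c z).1 + 1, (c z).2)) (k + 1) W), Finset.mul_sum]
    refine Finset.sum_congr rfl fun z _ => ?_
    rw [integral_const_mul, (hu z).2, prod_Gamma_update hc, sum_fst_update,
      Finset.card_insert_of_notMem hi]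
    push_cast
    rw [add_assoc (∑ z : Fin (k + 1), (c z).1) 1, add_comm (1 : ℝ)]
    ring

/-- The posterior mean of the weight of the last cause, in closed form. -/
theorem lastCauseMean_eq {c : ℕ → CauseData n} (h1 : ∀ z, 0 < (c z).1)
    (h2 : ∀ z i, 0 < (c z).2 i) (j : ℕ) :
    lastCauseMean c j = (c j).1 *
      subsetConv (assignmentWeight c j) (causeWeight ((c j).1 + 1, (c j).2)) Finset.univ /
      ((∑ z ∈ Finset.range j, (c z).1 + (c j).1 + n) *
        subsetConv (assignmentWeight c j) (causeWeight (c j)) Finset.univ) := by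
  have hS := measurableSet_simplexChart j
  set B := multiBeta fun z : Fin (j + 1) => (c z).1
  have hB : 0 < B := multiBeta_pos fun z => h1 z
  have e1 : evidence (fun z : Fin (j + 1) => (c z).1) (fun z => (c z).2) =
      B⁻¹ * ∫ x in simplexChart j, mixtureIntegrand c Finset.univ x := by
    rw [evidence, ← integral_const_mul]
    congr 1
    funext x
    simp only [dirichletDensity, likelihood, mixtureIntegrand]
    ring
  -- The extra factor `θ(z_j)` is absorbed by raising `α(z_j)` by one.
  have e2 : ∫ x in simplexChart j, simplexPoint x (Fin.last j) *
      (dirichletDensity (fun z : Fin (j + 1) => (c z).1) (simplexPoint x) *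
        likelihood (fun z => (c z).2) (simplexPoint x)) =
      B⁻¹ * ∫ x in simplexChart j, mixtureIntegrand
        (Function.update c (Fin.last j) ((c (Fin.last j)).1 + 1, (c (Fin.last j)).2))
        Finset.univ x := by
    rw [← integral_const_mul]
    refine setIntegral_congr_fun hS fun x hx => ?_
    simp only [dirichletDensity, likelihood, mixtureIntegrand, prod_rpow_update h1 _ hx,
      update_coe_snd]
    ring
  rw [lastCauseMean, posteriorMean, e1, e2,
    mul_div_mul_left _ _ (inv_ne_zero hB.ne'), (integral_mixtureIntegrand _ h1).2,
    (integral_mixtureIntegrand _ (update_fst_pos h1 _)).2, prod_Gamma_update h1, sum_fst_update,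
    Finset.card_univ, Fintype.card_fin, Fin.sum_univ_eq_sum_range (fun z => (c z).1),
    Finset.sum_range_succ, Fin.val_last]
  simp only [assignmentWeight, Function.update_self]
  have hcg : assignmentWeight (Function.update c j ((c j).1 + 1, (c j).2)) j =
      assignmentWeight c j :=
    assignmentWeight_congr fun z hz => Function.update_of_ne hz.ne _ _
  have hA : 0 < ∑ z ∈ Finset.range j, (c z).1 + (c j).1 + n :=
    add_pos_of_pos_of_nonneg
      (add_pos_of_nonneg_of_pos (Finset.sum_nonneg fun z _ => (h1 z).le) (h1 j)) n.cast_nonneg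
  have hG := Real.Gamma_add_one hA.ne'
  have hGpos := (Real.Gamma_pos_of_pos hA).ne'
  have hP : (∏ z : Fin (j + 1), Real.Gamma (c z).1) ≠ 0 :=
    (Finset.prod_pos fun z _ => Real.Gamma_pos_of_pos (h1 _)).ne'
  have hM := (subsetConv_pos h1 h2 j (h1 j) (h2 j) Finset.univ).ne'
  have hA' := hA.ne'
  -- The Gamma function in the denominator of the numerator integral has an argument larger by one;
  -- this produces the factor `∑ α + n`.
  rw [hcg, show ∑ z ∈ Finset.range j, (c z).1 + (c j).1 + 1 + (n : ℝ) =
    ∑ z ∈ Finset.range j, (c z).1 + (c j).1 + n + 1 by ring, hG]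
  field_simp

/-! ### Derivatives in the prior parameters -/

theorem subsetConv_right_comm (f g h : Finset (Fin n) → ℝ) :
    subsetConv (subsetConv f g) h = subsetConv (subsetConv f h) g := by
  funext W
  simp only [subsetConv, Finset.sum_mul]
  rw [Finset.sum_comm' (t' := W.powerset) (s' := fun U => (W \ U).powerset)]
  · refine Finset.sum_congr rfl fun U _ => Finset.sum_congr rfl fun V _ => ?_
    rw [sdiff_right_comm]
    ring
  · intro V U
    simp only [Finset.mem_powerset, Finset.subset_sdiff]
    constructor
    · rintro ⟨h1, h2, h3⟩; exact ⟨⟨h1, h3.symm⟩, h2⟩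
    · rintro ⟨⟨h1, h3⟩, h2⟩; exact ⟨h1, h2, h3.symm⟩

theorem subsetConv_assoc (f g h : Finset (Fin n) → ℝ) :
    subsetConv (subsetConv f g) h = subsetConv f (subsetConv g h) := by
  funext W
  simp only [subsetConv, Finset.sum_mul, Finset.mul_sum]
  rw [Finset.sum_sigma', Finset.sum_sigma']
  refine Finset.sum_bij' (fun p _ => ⟨p.1 ∪ p.2, p.1⟩) (fun p _ => ⟨p.2, p.1 \ p.2⟩) ?_ ?_ ?_ ?_ ?_
  · rintro ⟨V, U⟩ hp
    simp only [Finset.mem_sigma, Finset.mem_powerset, Finset.subset_sdiff] at hp ⊢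
    exact ⟨Finset.union_subset hp.1 hp.2.1, Finset.subset_union_left⟩
  · rintro ⟨V, U⟩ hp
    simp only [Finset.mem_sigma, Finset.mem_powerset] at hp ⊢
    exact ⟨hp.2.trans hp.1, Finset.sdiff_subset_sdiff hp.1 subset_rfl⟩
  · rintro ⟨V, U⟩ hp
    simp only [Finset.mem_sigma, Finset.mem_powerset, Finset.subset_sdiff] at hp ⊢
    rw [Finset.union_sdiff_cancel_left hp.2.2.symm]
  · rintro ⟨V, U⟩ hp
    simp only [Finset.mem_sigma, Finset.mem_powerset] at hp ⊢
    rw [Finset.union_sdiff_of_subset hp.2]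
  · rintro ⟨V, U⟩ hp
    simp only [Finset.mem_sigma, Finset.mem_powerset, Finset.subset_sdiff] at hp ⊢
    have e : W \ (V ∪ U) = (W \ V) \ U := sdiff_sdiff_left.symm
    rw [Finset.union_sdiff_cancel_left hp.2.2.symm, e, mul_assoc]

/-- The derivative in `α` at `0` of `causeWeight (α, b)`. -/
def logWeight (b : Fin n → ℝ) (V : Finset (Fin n)) : ℝ :=
  if V = ∅ then 0 else (V.card - 1).factorial * ∏ i ∈ V, b i

/-- Unlike `causeWeight_insert`, this splits off the last factor of the rising factorial and leaves
the prior parameter alone, as differentiation in it requires. -/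
theorem causeWeight_insert_last (c : CauseData n) {i : Fin n} {V : Finset (Fin n)} (hi : i ∉ V) :
    causeWeight c (insert i V) = c.2 i * (c.1 + V.card) * causeWeight c V := by
  rw [causeWeight, causeWeight, Finset.card_insert_of_notMem hi, Finset.prod_insert hi,
    Finset.prod_range_succ]
  ring

theorem logWeight_insert (b : Fin n → ℝ) {i : Fin n} {V : Finset (Fin n)} (hi : i ∉ V) :
    logWeight b (insert i V) = b i * (V.card * logWeight b V + if V = ∅ then 1 else 0) := by
  rw [logWeight, if_neg (Finset.insert_ne_empty i V), Finset.card_insert_of_notMem hi,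
    Finset.prod_insert hi, Nat.add_sub_cancel, logWeight]
  by_cases h : V = ∅
  · subst h; simp
  · rw [if_neg h, if_neg h, ← Nat.mul_factorial_pred (Finset.card_ne_zero.2
      (Finset.nonempty_iff_ne_empty.2 h))]
    push_cast
    ring

/-- This is the recursion that the product rule gives for the derivative of
`causeWeight_insert_last`. The contributions `a + |V \ U|` and `|U|` of the two factors add up to `a
+ |V|`. -/
theorem subsetConv_logWeight_insert (a : ℝ) (b : Fin n → ℝ) {i : Fin n} {V : Finset (Fin n)}
    (hi : i ∉ V) :
    subsetConv (causeWeight (a, b)) (logWeight b) (insert i V) =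
      b i * causeWeight (a, b) V +
        b i * (a + V.card) * subsetConv (causeWeight (a, b)) (logWeight b) V := by
  have key : ∀ U ∈ V.powerset,
      causeWeight (a, b) (insert i V \ U) * logWeight b U +
        causeWeight (a, b) (insert i V \ insert i U) * logWeight b (insert i U) =
      b i * (a + V.card) * (causeWeight (a, b) (V \ U) * logWeight b U) +
        (if U = ∅ then b i * causeWeight (a, b) (V \ U) else 0) := fun U hU => by
    have hUV := Finset.mem_powerset.1 hU
    have hiU : i ∉ U := fun h => hi (hUV h)
    have hcard : ((V \ U).card : ℝ) = V.card - U.card := by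
      rw [Finset.card_sdiff_of_subset hUV, Nat.cast_sub (Finset.card_le_card hUV)]
    rw [Finset.insert_sdiff_of_notMem _ hiU, Finset.insert_sdiff_insert,
      Finset.sdiff_insert_of_notMem hi, logWeight_insert b hiU,
      causeWeight_insert_last _ (fun h => hi (Finset.mem_sdiff.1 h).1), hcard]
    split_ifs <;> ring
  rw [subsetConv, Finset.sum_powerset_insert hi, ← Finset.sum_add_distrib,
    Finset.sum_congr rfl key, Finset.sum_add_distrib, ← Finset.mul_sum, Finset.sum_ite_eq',
    if_pos (Finset.empty_mem_powerset V), Finset.sdiff_empty, subsetConv]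
  ring

/-- The weights are the multilinear coefficients of `(1 - ∑ bᵢ xᵢ) ^ (-a)`, and `logWeight` holds
those of `-log (1 - ∑ bᵢ xᵢ)`; so differentiation in `a` is convolution with `logWeight`. -/
theorem hasDerivAt_causeWeight {a : ℝ → ℝ} {a' t₀ : ℝ} (b : Fin n → ℝ) (ha : HasDerivAt a a' t₀)
    (V : Finset (Fin n)) :
    HasDerivAt (fun t => causeWeight (a t, b) V)
      (a' * subsetConv (causeWeight (a t₀, b)) (logWeight b) V) t₀ := by
  induction V using Finset.induction_on with
  | empty => simpa [causeWeight, subsetConv, logWeight] using hasDerivAt_const t₀ (1 : ℝ)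
  | insert i V hi ih =>
    simp only [causeWeight_insert_last _ hi]
    rw [subsetConv_logWeight_insert _ _ hi]
    exact (((ha.add_const (V.card : ℝ)).const_mul (b i)).fun_mul ih).congr_deriv (by ring)

/-- The directional derivative of the logarithm of `assignmentWeight` when the prior parameters
move with velocity `v`. -/
def cumulant (b : ℕ → Fin n → ℝ) (v : ℕ → ℝ) (j : ℕ) (V : Finset (Fin n)) : ℝ :=
  ∑ z ∈ Finset.range j, v z * logWeight (b z) V

theorem subsetConv_add_right (f g h : Finset (Fin n) → ℝ) (W : Finset (Fin n)) :
    subsetConv f (fun V => g V + h V) W = subsetConv f g W + subsetConv f h W := by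
  simp only [subsetConv, mul_add, Finset.sum_add_distrib]

theorem subsetConv_mul_right (f g : Finset (Fin n) → ℝ) (r : ℝ) (W : Finset (Fin n)) :
    subsetConv f (fun V => r * g V) W = r * subsetConv f g W := by
  simp only [subsetConv, Finset.mul_sum]
  exact Finset.sum_congr rfl fun _ _ => by ring

/-- `assignmentWeight` is a convolution product over the causes, so logarithmic derivatives add up.
-/
theorem hasDerivAt_assignmentWeight {c : ℝ → ℕ → CauseData n} {b : ℕ → Fin n → ℝ} {v : ℕ → ℝ}
    {t₀ : ℝ} (hb : ∀ t z, (c t z).2 = b z)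
    (hv : ∀ z, HasDerivAt (fun t => (c t z).1) (v z) t₀) : ∀ j W,
    HasDerivAt (fun t => assignmentWeight (c t) j W)
      (subsetConv (assignmentWeight (c t₀) j) (cumulant b v j) W) t₀
  | 0, W => by
    simpa [assignmentWeight, cumulant, subsetConv] using hasDerivAt_const t₀ _
  | j + 1, W => by
    have hc : ∀ t, c t j = ((c t j).1, b j) := fun t => Prod.ext rfl (hb t j)
    have e : cumulant b v (j + 1) = fun V => cumulant b v j V + v j * logWeight (b j) V := by
      funext V; rw [cumulant, Finset.sum_range_succ, ← cumulant]
    have e2 : assignmentWeight (c t₀) (j + 1) =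
      subsetConv (assignmentWeight (c t₀) j) (causeWeight (c t₀ j)) := rfl
    have e3 : subsetConv (assignmentWeight (c t₀) (j + 1)) (cumulant b v (j + 1)) W =
        ∑ V ∈ W.powerset, (subsetConv (assignmentWeight (c t₀) j) (cumulant b v j) (W \ V) *
          causeWeight (c t₀ j) V + assignmentWeight (c t₀) j (W \ V) *
          (v j * subsetConv (causeWeight (c t₀ j)) (logWeight (b j)) V)) := by
      rw [e, subsetConv_add_right, subsetConv_mul_right, e2,
        subsetConv_right_comm _ _ (cumulant b v j), subsetConv_assoc _ _ (logWeight (b j)),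
        ← subsetConv_mul_right, Finset.sum_add_distrib]
      rfl
    rw [e3]
    refine HasDerivAt.fun_sum fun V _ => ?_
    have h := hasDerivAt_causeWeight (b j) (hv j) V
    simp only [← hc] at h
    exact (hasDerivAt_assignmentWeight hb hv j (W \ V)).fun_mul h

/-- Since `f ∅ = 1`, convolution with `f` is unitriangular with respect to inclusion. -/
theorem eq_zero_of_subsetConv_eq_zero {f g : Finset (Fin n) → ℝ} (hf : f ∅ = 1)
    (h : ∀ W, subsetConv f g W = 0) : ∀ W, g W = 0 := by
  intro W
  induction W using Finset.strongInduction with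
  | H W ih =>
    have := h W
    rw [subsetConv, Finset.sum_eq_single_of_mem W (Finset.mem_powerset_self W), Finset.sdiff_self,
      hf, one_mul] at this
    · exact this
    · intro V hV hne
      rw [ih V (Finset.ssubset_iff_subset_ne.2 ⟨Finset.mem_powerset.1 hV, hne⟩), mul_zero]

/-! ### Polynomial identities on open sets -/

/-- The identity theorem permits evaluation at vectors that are not admissible probabilities, in
particular at multiples of indicator vectors. -/
theorem eq_zero_of_eqOn_open {f : (Fin n → ℝ) → ℝ} (hf : AnalyticOnNhd ℝ f Set.univ)
    {O : Set (Fin n → ℝ)} (hO : IsOpen O) (hne : O.Nonempty) (h : ∀ b ∈ O, f b = 0)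
    (b : Fin n → ℝ) : f b = 0 := by
  obtain ⟨b₀, hb₀⟩ := hne
  have := hf.eq_of_eventuallyEq (g := fun _ => 0) analyticOnNhd_const
    (z₀ := b₀) (Filter.mem_of_superset (hO.mem_nhds hb₀) h)
  exact congrFun this b

theorem analyticOnNhd_prod_apply (V : Finset (Fin n)) :
    AnalyticOnNhd ℝ (fun b : Fin n → ℝ => ∏ i ∈ V, b i) Set.univ := fun b _ =>
  Finset.analyticAt_fun_prod _ fun i _ => (ContinuousLinearMap.proj (R := ℝ) i).analyticAt b

theorem analyticOnNhd_subsetConv (f : Finset (Fin n) → ℝ) (a : ℝ) (W : Finset (Fin n)) :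
    AnalyticOnNhd ℝ (fun b : Fin n → ℝ => subsetConv f (causeWeight (a, b)) W) Set.univ :=
  fun b _ => Finset.analyticAt_fun_sum _ fun V _ => analyticAt_const.fun_mul
    (show AnalyticAt ℝ (fun b : Fin n → ℝ =>
      (∏ l ∈ Finset.range V.card, (a + l)) * ∏ i ∈ V, b i) b from
      analyticAt_const.fun_mul (analyticOnNhd_prod_apply V b (Set.mem_univ b)))

theorem prod_indicator (t : ℝ) (U V : Finset (Fin n)) :
    ∏ i ∈ U, (if i ∈ V then t else 0) = if U ⊆ V then t ^ U.card else 0 := by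
  split_ifs with h
  · rw [Finset.prod_congr rfl fun i hi => if_pos (h hi), Finset.prod_const]
  · obtain ⟨i, hi, hiV⟩ := Finset.not_subset.1 h
    exact Finset.prod_eq_zero hi (if_neg hiV)

/-- A multi-affine function that vanishes on an open set has zero coefficients. -/
theorem eq_zero_of_multiaffine_eq_zero {w : Finset (Fin n) → ℝ} {O : Set (Fin n → ℝ)}
    (hO : IsOpen O) (hne : O.Nonempty) (h : ∀ b ∈ O, ∑ V, w V * ∏ i ∈ V, b i = 0) : w = 0 := by
  have h2 := eq_zero_of_eqOn_open (f := fun b => ∑ V, w V * ∏ i ∈ V, b i)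
    (fun b _ => Finset.analyticAt_fun_sum _ fun V _ =>
      analyticAt_const.mul (analyticOnNhd_prod_apply V b (Set.mem_univ b))) hO hne h
  funext W
  -- At the indicator vector of `W` the hypothesis says that the coefficients of the subsets of `W`
  -- sum to zero, which is a convolution with the constant `1`.
  refine eq_zero_of_subsetConv_eq_zero (f := fun _ => 1) rfl (fun W => ?_) W
  have h3 := h2 fun i => if i ∈ W then 1 else 0
  simp only [prod_indicator, one_pow, mul_ite, mul_one, mul_zero] at h3
  rw [← Finset.sum_filter] at h3
  rw [← h3, subsetConv]
  refine Finset.sum_congr ?_ fun _ _ => one_mul _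
  ext V; simp

/-- The vectors are chosen greedily. While there are fewer than `2 ^ n`, some nonzero functional
kills their span; on monomial vectors it is a nonzero multi-affine function of `b`, which cannot
vanish on all of the next open set. -/
theorem exists_linearIndependent_monomials : ∀ (e : ℕ), e ≤ 2 ^ n →
    ∀ O : ℕ → Set (Fin n → ℝ), (∀ z, IsOpen (O z)) → (∀ z, (O z).Nonempty) →
    ∃ β : Fin e → Fin n → ℝ, (∀ z : Fin e, β z ∈ O z) ∧
      LinearIndependent ℝ fun (z : Fin e) (V : Finset (Fin n)) => ∏ i ∈ V, β z i
  | 0, _, _, _, _ => ⟨fun z => z.elim0, fun z => z.elim0, linearIndependent_empty_type⟩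
  | e + 1, he, O, hO, hne => by
    obtain ⟨β, hβ, hli⟩ := exists_linearIndependent_monomials e (by omega) O hO hne
    set S := Submodule.span ℝ (Set.range fun (z : Fin e) (V : Finset (Fin n)) => ∏ i ∈ V, β z i)
    have hlt : S < ⊤ := by
      refine Submodule.lt_top_of_finrank_lt_finrank ?_
      rw [finrank_span_eq_card hli]
      simpa using he
    obtain ⟨b, hb, hbS⟩ : ∃ b ∈ O e, (fun V : Finset (Fin n) => ∏ i ∈ V, b i) ∉ S := by
      by_contra! hcon
      obtain ⟨φ, hφ, hle⟩ := Submodule.exists_le_ker_of_lt_top S hlt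
      refine hφ (LinearMap.pi_ext' fun V => LinearMap.ext_ring ?_)
      have := eq_zero_of_multiaffine_eq_zero (w := fun V => φ (Pi.single V 1)) (hO e) (hne e)
        fun b hb => by
          have h0 : φ (fun V => ∏ i ∈ V, b i) = 0 := hle (hcon b hb)
          rw [LinearMap.pi_apply_eq_sum_univ φ] at h0
          rw [← h0]
          refine Finset.sum_congr rfl fun V _ => ?_
          rw [smul_eq_mul, mul_comm]
          congr 2
          funext U
          simp [Pi.single_apply, eq_comm]
      simpa using congrFun this V
    refine ⟨Fin.snoc β b, fun z => ?_, ?_⟩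
    · refine Fin.lastCases ?_ (fun i => ?_) z
      · simpa using hb
      · simpa using hβ i
    · have hfun : (fun (z : Fin (e + 1)) (V : Finset (Fin n)) =>
          ∏ i ∈ V, (Fin.snoc β b : Fin (e + 1) → Fin n → ℝ) z i) =
          (Fin.snoc (fun (z : Fin e) (V : Finset (Fin n)) => ∏ i ∈ V, β z i)
            (fun V => ∏ i ∈ V, b i) : Fin (e + 1) → Finset (Fin n) → ℝ) := by
        funext z
        refine Fin.lastCases ?_ (fun i => ?_) z <;> simp
      rw [hfun]
      exact linearIndependent_finSnoc.2 ⟨hli, hbS⟩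

/-! ### The posterior means determine the weights at first order -/

theorem causeWeight_indicator (a t : ℝ) (U V : Finset (Fin n)) :
    causeWeight (a, fun i => if i ∈ V then t else 0) U =
      if U ⊆ V then (∏ l ∈ Finset.range U.card, (a + l)) * t ^ U.card else 0 := by
  rw [causeWeight, prod_indicator]
  split_ifs <;> simp

theorem subsetConv_indicator (f : Finset (Fin n) → ℝ) (a t : ℝ) (V : Finset (Fin n)) :
    subsetConv f (causeWeight (a, fun i => if i ∈ V then t else 0)) Finset.univ =
      ∑ U ∈ V.powerset, f Uᶜ * ((∏ l ∈ Finset.range U.card, (a + l)) * t ^ U.card) := by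
  simp only [subsetConv, causeWeight_indicator, mul_ite, mul_zero]
  rw [← Finset.sum_filter]
  refine Finset.sum_congr ?_ fun U _ => by rw [Finset.compl_eq_univ_sdiff]
  ext U; simp

theorem prod_range_add_one_gt {a : ℝ} (ha : 0 < a) {k : ℕ} (hk : k ≠ 0) :
    ∏ l ∈ Finset.range k, (a + l) < ∏ l ∈ Finset.range k, (a + 1 + l) :=
  Finset.prod_lt_prod_of_nonempty (fun l _ => by positivity) (fun l _ => by linarith)
    (Finset.nonempty_range_iff.2 hk)

/-- If the first-order variation of `a N / (K M)` vanishes for all `b` in an open set, where `N`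
and `M` are the numerator and denominator polynomials of the posterior mean, then the variation of
the coefficients vanishes. -/
theorem eq_zero_of_variation_eq_zero {G G' : Finset (Fin n) → ℝ} (hG : G Finset.univ ≠ 0)
    (hG0 : G ∅ = 1) (hG0' : G' ∅ = 0) {a K A' : ℝ} (ha : 0 < a) (hK : K ≠ 0)
    {O : Set (Fin n → ℝ)} (hO : IsOpen O) (hne : O.Nonempty)
    (h : ∀ b ∈ O,
      K * (subsetConv G' (causeWeight (a + 1, b)) Finset.univ *
          subsetConv G (causeWeight (a, b)) Finset.univ -
        subsetConv G (causeWeight (a + 1, b)) Finset.univ *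
          subsetConv G' (causeWeight (a, b)) Finset.univ) -
      A' * (subsetConv G (causeWeight (a + 1, b)) Finset.univ *
        subsetConv G (causeWeight (a, b)) Finset.univ) = 0) :
    A' = 0 ∧ ∀ V, G' V = 0 := by
  have han := fun (f : Finset (Fin n) → ℝ) (a : ℝ) (b : Fin n → ℝ) =>
    analyticOnNhd_subsetConv f a Finset.univ b (Set.mem_univ b)
  have hall := eq_zero_of_eqOn_open (fun b _ =>
    (analyticAt_const.fun_mul (((han G' (a + 1) b).fun_mul (han G a b)).fun_sub
      ((han G (a + 1) b).fun_mul (han G' a b)))).fun_sub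
      (analyticAt_const.fun_mul ((han G (a + 1) b).fun_mul (han G a b)))) hO hne h
  have hA : A' = 0 := by
    -- At `b = 0` only `G univ` and `G' univ` survive; the bracket cancels and `A' * G univ ^ 2 = 0`
    -- remains. The vector `0` is written as an `if` so that `subsetConv_indicator` applies.
    have := hall fun i => if i ∈ (∅ : Finset (Fin n)) then 0 else 0
    simp only [subsetConv_indicator] at this
    simpa [hG, mul_comm (G' Finset.univ)] using this
  refine ⟨hA, ?_⟩
  have hD : ∀ (V : Finset (Fin n)) (t : ℝ),
      (∑ U ∈ V.powerset, G' Uᶜ * ((∏ l ∈ Finset.range U.card, (a + 1 + l)) * t ^ U.card)) *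
        (∑ U ∈ V.powerset, G Uᶜ * ((∏ l ∈ Finset.range U.card, (a + l)) * t ^ U.card)) -
      (∑ U ∈ V.powerset, G Uᶜ * ((∏ l ∈ Finset.range U.card, (a + 1 + l)) * t ^ U.card)) *
        (∑ U ∈ V.powerset, G' Uᶜ * ((∏ l ∈ Finset.range U.card, (a + l)) * t ^ U.card)) = 0 :=
    fun V t => by
      have := hall fun i => if i ∈ V then t else 0
      simpa [subsetConv_indicator, hA, hK] using this
  -- With `A' = 0` the ratio of the two polynomials is stationary. This should force `G'` to be a
  -- multiple of `G`, and the values at `∅` then force the multiple to be `0`.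
  set r := G' Finset.univ / G Finset.univ
  have hprop : ∀ V : Finset (Fin n), G' Vᶜ = r * G Vᶜ := by
    intro V
    induction V using Finset.strongInduction with
    | H V ih =>
    by_cases hV : V = ∅
    · subst hV; simp only [Finset.compl_empty, r]; field_simp
    have hcard : V.card ≠ 0 := Finset.card_ne_zero.2 (Finset.nonempty_iff_ne_empty.2 hV)
    have split : ∀ a t : ℝ,
        ∑ U ∈ V.powerset, G' Uᶜ * ((∏ l ∈ Finset.range U.card, (a + l)) * t ^ U.card) =
        r * (∑ U ∈ V.powerset, G Uᶜ * ((∏ l ∈ Finset.range U.card, (a + l)) * t ^ U.card)) +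
        (G' Vᶜ - r * G Vᶜ) * ((∏ l ∈ Finset.range V.card, (a + l)) * t ^ V.card) := fun a t => by
      rw [← sub_eq_iff_eq_add', Finset.mul_sum, ← Finset.sum_sub_distrib,
        Finset.sum_eq_single_of_mem V (Finset.mem_powerset_self V)]
      · ring
      · intro U hU hne
        rw [ih U (Finset.ssubset_iff_subset_ne.2 ⟨Finset.mem_powerset.1 hU, hne⟩)]
        ring
    by_contra hcon
    have hcon' : G' Vᶜ - r * G Vᶜ ≠ 0 := sub_ne_zero.2 hcon
    -- By the induction hypothesis all terms cancel except `(G' Vᶜ - r * G Vᶜ) * t ^ V.card * f t`.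
    -- So `f` vanishes for `t ≠ 0`, and by continuity at `0`. But `f 0` is `G univ` times the
    -- difference of the rising factorials of `a + 1` and `a`, which is not zero for nonempty `V`.
    set f : ℝ → ℝ := fun t => (∏ l ∈ Finset.range V.card, (a + 1 + l)) *
        (∑ U ∈ V.powerset, G Uᶜ * ((∏ l ∈ Finset.range U.card, (a + l)) * t ^ U.card)) -
      (∏ l ∈ Finset.range V.card, (a + l)) *
        (∑ U ∈ V.powerset, G Uᶜ * ((∏ l ∈ Finset.range U.card, (a + 1 + l)) * t ^ U.card)) with hf
    have hf0 : ∀ t ∈ ({0}ᶜ : Set ℝ), f t = (fun _ => 0) t := fun t ht => by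
      have ht' : t ^ V.card ≠ 0 := pow_ne_zero _ ht
      have := hD V t
      rw [split, split] at this
      have h2 : (G' Vᶜ - r * G Vᶜ) * t ^ V.card * f t = 0 := by
        rw [← this, hf]; ring
      exact (mul_eq_zero.1 h2).resolve_left (mul_ne_zero hcon' ht')
    have hcont : Continuous f := by fun_prop
    have hzero := congrFun (hcont.ext_on (dense_compl_singleton (0 : ℝ)) continuous_const hf0) 0
    have hval : ∀ a : ℝ,
        ∑ U ∈ V.powerset, G Uᶜ * ((∏ l ∈ Finset.range U.card, (a + l)) * (0 : ℝ) ^ U.card) =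
          G Finset.univ := fun a => by
      rw [Finset.sum_eq_single_of_mem ∅ (Finset.empty_mem_powerset V)]
      · simp
      · intro U _ hU
        rw [zero_pow (Finset.card_ne_zero.2 (Finset.nonempty_iff_ne_empty.2 hU)), mul_zero,
          mul_zero]
    simp only [hf, hval] at hzero
    have hlt := prod_range_add_one_gt ha hcard
    rw [← sub_mul] at hzero
    exact (mul_ne_zero (sub_pos.2 hlt).ne' hG) hzero
  have hr : r = 0 := by
    have := hprop Finset.univ
    rw [Finset.compl_univ, hG0, hG0', mul_one] at this
    exact this.symm
  intro V
  have := hprop Vᶜ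
  rwa [hr, zero_mul, compl_compl] at this

/-- The closed form of the posterior mean of the last cause, with data `d`, when the earlier causes
have total prior parameter `A` and assignment weights `G`. -/
noncomputable def meanOfWeights (A : ℝ) (G : Finset (Fin n) → ℝ) (d : CauseData n) : ℝ :=
  d.1 * subsetConv G (causeWeight (d.1 + 1, d.2)) Finset.univ /
    ((A + d.1 + n) * subsetConv G (causeWeight d) Finset.univ)

theorem hasDerivAt_meanOfWeights {A : ℝ → ℝ} {G : ℝ → Finset (Fin n) → ℝ} {A' t₀ : ℝ}
    {G' : Finset (Fin n) → ℝ} {d : CauseData n} (hA : HasDerivAt A A' t₀)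
    (hG : ∀ W, HasDerivAt (fun t => G t W) (G' W) t₀) (hK : A t₀ + d.1 + n ≠ 0)
    (hM : subsetConv (G t₀) (causeWeight d) Finset.univ ≠ 0) :
    HasDerivAt (fun t => meanOfWeights (A t) (G t) d)
      (d.1 * ((A t₀ + d.1 + n) * (subsetConv G' (causeWeight (d.1 + 1, d.2)) Finset.univ *
          subsetConv (G t₀) (causeWeight d) Finset.univ -
        subsetConv (G t₀) (causeWeight (d.1 + 1, d.2)) Finset.univ *
          subsetConv G' (causeWeight d) Finset.univ) -
      A' * (subsetConv (G t₀) (causeWeight (d.1 + 1, d.2)) Finset.univ *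
        subsetConv (G t₀) (causeWeight d) Finset.univ)) /
        ((A t₀ + d.1 + n) * subsetConv (G t₀) (causeWeight d) Finset.univ) ^ 2) t₀ := by
  have hc : ∀ g : Finset (Fin n) → ℝ, HasDerivAt (fun t => subsetConv (G t) g Finset.univ)
      (subsetConv G' g Finset.univ) t₀ := fun g =>
    HasDerivAt.fun_sum fun V _ => (hG _).mul_const _
  exact (((hc _).const_mul d.1).fun_div (((hA.add_const d.1).add_const (n : ℝ)).fun_mul (hc _))
    (mul_ne_zero hK hM)).congr_deriv (by ring)

/-! ### The posterior means as functions of the earlier prior parameters -/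

theorem contDiff_causeWeight {E : Type*} [NormedAddCommGroup E] [NormedSpace ℝ E] {a : E → ℝ}
    (ha : ContDiff ℝ 1 a) (b : Fin n → ℝ) (V : Finset (Fin n)) :
    ContDiff ℝ 1 fun y => causeWeight (a y, b) V := by
  unfold causeWeight
  exact (contDiff_prod fun l _ => ha.add contDiff_const).mul
    (contDiff_const (c := ∏ i ∈ V, b i))

theorem contDiff_assignmentWeight {E : Type*} [NormedAddCommGroup E] [NormedSpace ℝ E]
    {c : E → ℕ → CauseData n} {b : ℕ → Fin n → ℝ} (hb : ∀ y z, (c y z).2 = b z)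
    (ha : ∀ z, ContDiff ℝ 1 fun y => (c y z).1) :
    ∀ j W, ContDiff ℝ 1 fun y => assignmentWeight (c y) j W
  | 0, _ => contDiff_const
  | j + 1, W => by
    have hc : ∀ y, c y j = ((c y j).1, b j) := fun y => Prod.ext rfl (hb y j)
    have h := contDiff_causeWeight (ha j) (b j)
    simp only [← hc] at h
    exact ContDiff.sum fun V _ => (contDiff_assignmentWeight hb ha j _).mul (h V)

/-- A separating family spans the dual space, so it contains a basis, which has `e` elements. -/
theorem exists_forall_eq_zero_of_separating {e : ℕ} {ι : Type*}
    (l : ι → (Fin e → ℝ) →ₗ[ℝ] ℝ) (hl : ∀ v, (∀ i, l i v = 0) → v = 0) :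
    ∃ p : Fin e → ι, ∀ v, (∀ k, l (p k) v = 0) → v = 0 := by
  have htop : Submodule.span ℝ (Set.range l) = ⊤ := by
    refine Submodule.span_eq_top_of_ne_zero (R := ℝ) fun v hv => ?_
    by_contra! hcon
    exact hv (hl v fun i => hcon _ ⟨i, rfl⟩)
  obtain ⟨f, hf, hspan, -⟩ := Submodule.exists_fun_fin_finrank_span_eq ℝ (Set.range l)
  have hd : Module.finrank ℝ (Submodule.span ℝ (Set.range l)) = e := by
    rw [htop, finrank_top]
    exact Subspace.dual_finrank_eq.trans (by simp)
  choose p hp using hf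
  refine ⟨fun k => p (k.cast hd.symm), fun v hv => hl v fun i => ?_⟩
  have hle : Submodule.span ℝ (Set.range f) ≤
      LinearMap.ker (LinearMap.applyₗ (R := ℝ) (M₂ := ℝ) v) := by
    rw [Submodule.span_le]
    rintro _ ⟨k, rfl⟩
    rw [← hp]
    exact hv (k.cast hd)
  exact hle (by rw [hspan, htop]; trivial)

/-- The data `c` with the first `e` causes replaced by `(y z, β z)`. -/
def replaceCauses (c : ℕ → CauseData n) {e : ℕ} (β : Fin e → Fin n → ℝ) (y : Fin e → ℝ) :
    ℕ → CauseData n :=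
  fun z => if h : z < e then (y ⟨z, h⟩, β ⟨z, h⟩) else c z

theorem replaceCauses_of_lt (c : ℕ → CauseData n) {e : ℕ} (β : Fin e → Fin n → ℝ) (y : Fin e → ℝ)
    (z : Fin e) : replaceCauses c β y z = (y z, β z) :=
  dif_pos z.2

theorem replaceCauses_snd (c : ℕ → CauseData n) {e : ℕ} (β : Fin e → Fin n → ℝ)
    (y y' : Fin e → ℝ) (z : ℕ) : (replaceCauses c β y z).2 = (replaceCauses c β y' z).2 := by
  unfold replaceCauses; split_ifs <;> rfl

theorem forall_replaceCauses {p : ℕ → CauseData n → Prop} {c : ℕ → CauseData n} {e : ℕ}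
    {β : Fin e → Fin n → ℝ} {y : Fin e → ℝ} (h1 : ∀ z : Fin e, p z (y z, β z))
    (h2 : ∀ z, p z (c z)) (z : ℕ) : p z (replaceCauses c β y z) := by
  unfold replaceCauses
  split_ifs with h
  · exact h1 ⟨z, h⟩
  · exact h2 z

theorem contDiff_replaceCauses (c : ℕ → CauseData n) {e : ℕ} (β : Fin e → Fin n → ℝ) (z : ℕ) :
    ContDiff ℝ 1 fun y => (replaceCauses c β y z).1 := by
  unfold replaceCauses
  split_ifs
  · exact contDiff_apply ℝ ℝ _
  · exact contDiff_const

theorem hasDerivAt_replaceCauses (c : ℕ → CauseData n) {e : ℕ} (β : Fin e → Fin n → ℝ)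
    (y v : Fin e → ℝ) (z : ℕ) :
    HasDerivAt (fun t : ℝ => (replaceCauses c β (y + t • v) z).1)
      (if h : z < e then v ⟨z, h⟩ else 0) 0 := by
  unfold replaceCauses
  split_ifs with h
  · simpa using ((hasDerivAt_id (0 : ℝ)).mul_const (v ⟨z, h⟩)).const_add (y ⟨z, h⟩)
  · exact hasDerivAt_const _ _

/-- The posterior mean of cause `j` with data `d`, as a function of the prior parameters `y` of the
first causes. -/
noncomputable def meanAt (c : ℕ → CauseData n) {e : ℕ} (β : Fin e → Fin n → ℝ) (j : ℕ)
    (d : CauseData n) (y : Fin e → ℝ) : ℝ :=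
  meanOfWeights (∑ z ∈ Finset.range j, (replaceCauses c β y z).1)
    (assignmentWeight (replaceCauses c β y) j) d

section

variable {c : ℕ → CauseData n} {e j : ℕ} {β : Fin e → Fin n → ℝ} {y : Fin e → ℝ}

theorem replaceCauses_pos (h1 : ∀ z, 0 < (c z).1) (h2 : ∀ z i, 0 < (c z).2 i)
    (hβ : ∀ z i, 0 < β z i) (hy : ∀ z, 0 < y z) :
    (∀ z, 0 < (replaceCauses c β y z).1) ∧ ∀ z i, 0 < (replaceCauses c β y z).2 i :=
  ⟨forall_replaceCauses (p := fun _ d => 0 < d.1) hy h1,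
    forall_replaceCauses (p := fun _ d => ∀ i, 0 < d.2 i) hβ h2⟩

theorem replaceCauses_total_pos (h1 : ∀ z, 0 < (replaceCauses c β y z).1) {a : ℝ} (ha : 0 < a) :
    0 < ∑ z ∈ Finset.range j, (replaceCauses c β y z).1 + a + n :=
  add_pos_of_pos_of_nonneg
    (add_pos_of_nonneg_of_pos (Finset.sum_nonneg fun z _ => (h1 z).le) ha) n.cast_nonneg

theorem contDiffAt_meanAt (h1 : ∀ z, 0 < (c z).1) (h2 : ∀ z i, 0 < (c z).2 i)
    (hβ : ∀ z i, 0 < β z i) (hy : ∀ z, 0 < y z) {d : CauseData n} (hd1 : 0 < d.1)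
    (hd2 : ∀ i, 0 < d.2 i) : ContDiffAt ℝ 1 (meanAt c β j d) y := by
  obtain ⟨p1, p2⟩ := replaceCauses_pos h1 h2 hβ hy
  have hG := contDiff_assignmentWeight (c := replaceCauses c β)
    (fun y' z => replaceCauses_snd c β y' y z) (contDiff_replaceCauses c β) j
  have hc : ∀ g : Finset (Fin n) → ℝ, ContDiff ℝ 1 fun y =>
      subsetConv (assignmentWeight (replaceCauses c β y) j) g Finset.univ := fun g =>
    ContDiff.sum fun V _ => (hG _).mul contDiff_const
  unfold meanAt meanOfWeights
  refine ContDiffAt.div (contDiff_const.mul (hc _)).contDiffAt (ContDiff.contDiffAt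
    (((ContDiff.add (ContDiff.sum fun z _ => contDiff_replaceCauses c β z) contDiff_const).add
      contDiff_const).mul (hc _)))
    (mul_pos (replaceCauses_total_pos p1 hd1) (subsetConv_pos p1 p2 j hd1 hd2 _)).ne'

/-- A direction in which all posterior means are stationary is zero. -/
theorem eq_zero_of_fderiv_meanAt_eq_zero (he : e ≤ j) (he0 : 0 < e) (h1 : ∀ z, 0 < (c z).1)
    (h2 : ∀ z i, 0 < (c z).2 i) (hβ : ∀ z i, 0 < β z i)
    (hli : LinearIndependent ℝ fun (z : Fin e) (V : Finset (Fin n)) => ∏ i ∈ V, β z i)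
    (hy : ∀ z, 0 < y z) {a : ℝ} (ha : 0 < a) {O : Set (Fin n → ℝ)} (hO : IsOpen O)
    (hne : O.Nonempty) (hOpos : ∀ b ∈ O, ∀ i, 0 < b i) (v : Fin e → ℝ)
    (hv : ∀ b ∈ O, fderiv ℝ (meanAt c β j (a, b)) y v = 0) : v = 0 := by
  obtain ⟨p1, p2⟩ := replaceCauses_pos h1 h2 hβ hy
  have hy0 : y + (0 : ℝ) • v = y := by simp
  set w : ℕ → ℝ := fun z => if h : z < e then v ⟨z, h⟩ else 0
  have hw : ∀ f : ℕ → ℝ, ∑ z ∈ Finset.range j, w z * f z = ∑ z : Fin e, v z * f z := fun f => by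
    rw [← Finset.sum_subset (Finset.range_subset_range.2 he), ← Fin.sum_univ_eq_sum_range
      (fun z => w z * f z)]
    · exact Finset.sum_congr rfl fun z _ => by simp [w]
    · intro z _ hz
      simp [w, show ¬ z < e by simpa using hz]
  have hA : HasDerivAt (fun t : ℝ => ∑ z ∈ Finset.range j, (replaceCauses c β (y + t • v) z).1)
      (∑ z ∈ Finset.range j, w z) 0 :=
    HasDerivAt.fun_sum fun z _ => hasDerivAt_replaceCauses c β y v z
  have hG := hasDerivAt_assignmentWeight (c := fun t : ℝ => replaceCauses c β (y + t • v))
    (b := fun z => (replaceCauses c β y z).2) (fun t z => replaceCauses_snd c β _ y z)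
    (hasDerivAt_replaceCauses c β y v) j
  simp only [hy0] at hG
  set κ := cumulant (fun z => (replaceCauses c β y z).2) w j
  have hκ0 : κ ∅ = 0 := by simp [κ, cumulant, logWeight]
  -- With no earlier cause, `G univ` would be `0` for `n > 0`; here `0 < e ≤ j`.
  have hj : ∃ l, j = l + 1 := ⟨j - 1, by omega⟩
  have hGpos : 0 < assignmentWeight (replaceCauses c β y) j Finset.univ := by
    obtain ⟨l, rfl⟩ := hj
    exact subsetConv_pos p1 p2 l (p1 l) (p2 l) _
  obtain ⟨hA0, hG0⟩ := eq_zero_of_variation_eq_zero (A' := ∑ z ∈ Finset.range j, w z)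
    (G' := subsetConv (assignmentWeight (replaceCauses c β y) j) κ) hGpos.ne'
    (assignmentWeight_empty _ j) (by simpa [subsetConv, assignmentWeight_empty] using hκ0) ha
    (replaceCauses_total_pos (j := j) p1 ha).ne' hO hne fun b hb => by
      have hM := subsetConv_pos p1 p2 j (d := (a, b)) ha (hOpos b hb) Finset.univ
      have hK := replaceCauses_total_pos (j := j) p1 ha
      have hd1 := hasDerivAt_meanOfWeights (d := (a, b)) hA (fun W => by simpa [hy0] using hG W)
        (by simpa [hy0] using hK.ne') (by simpa [hy0] using hM.ne')
      simp only [hy0] at hd1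
      have hline : HasDerivAt (fun t : ℝ => y + t • v) v 0 := by
        simpa using ((hasDerivAt_id (0 : ℝ)).smul_const v).const_add y
      have hF : HasFDerivAt (meanAt c β j (a, b)) (fderiv ℝ (meanAt c β j (a, b)) y)
          (y + (0 : ℝ) • v) := by
        rw [hy0]
        exact ((contDiffAt_meanAt h1 h2 hβ hy ha (hOpos b hb)).differentiableAt
          one_ne_zero).hasFDerivAt
      have hd2 := hF.comp_hasDerivAt (0 : ℝ) hline
      rw [hv b hb] at hd2
      have := hd1.unique hd2
      rw [div_eq_zero_iff, or_iff_left (pow_ne_zero 2 (mul_pos hK hM).ne')] at this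
      exact (mul_eq_zero.1 this).resolve_left ha.ne'
  have hκ := eq_zero_of_subsetConv_eq_zero (assignmentWeight_empty _ j) hG0
  -- The coordinate at `∅`, where `logWeight` is zero, comes from the stationarity of the sum of the
  -- prior parameters; the other coordinates come from `κ V = 0`, divided by the factorial.
  have hcomb : ∑ z, v z • (fun V : Finset (Fin n) => ∏ i ∈ V, β z i) = 0 := by
    funext V
    rw [Finset.sum_apply]
    simp only [Pi.smul_apply, smul_eq_mul, Pi.zero_apply]
    by_cases hV : V = ∅
    · subst hV
      have := hw fun _ => 1
      simp only [mul_one] at this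
      simpa [← this] using hA0
    · have h := hκ V
      simp only [κ, cumulant] at h
      rw [hw fun z => logWeight (replaceCauses c β y z).2 V] at h
      simp only [replaceCauses_of_lt, logWeight, if_neg hV] at h
      have hf : ((V.card - 1).factorial : ℝ) ≠ 0 := Nat.cast_ne_zero.2 (Nat.factorial_ne_zero _)
      refine (mul_eq_zero.1 ?_).resolve_left hf
      rw [← h, Finset.mul_sum]
      exact Finset.sum_congr rfl fun z _ => by ring
  exact funext fun z => Fintype.linearIndependent_iff.1 hli v hcomb z

/-- For suitable `b k` the derivative of the vector of posterior means is injective, hence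
bijective, and the image of every neighbourhood of `y` is a neighbourhood. -/
theorem exists_dimH_image_meanAt (he : e ≤ j) (he0 : 0 < e) (h1 : ∀ z, 0 < (c z).1)
    (h2 : ∀ z i, 0 < (c z).2 i) (hβ : ∀ z i, 0 < β z i)
    (hli : LinearIndependent ℝ fun (z : Fin e) (V : Finset (Fin n)) => ∏ i ∈ V, β z i)
    (hy : ∀ z, 0 < y z) {a : ℝ} (ha : 0 < a) {O : Set (Fin n → ℝ)} (hO : IsOpen O)
    (hne : O.Nonempty) (hOpos : ∀ b ∈ O, ∀ i, 0 < b i) :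
    ∃ b : Fin e → Fin n → ℝ, (∀ k, b k ∈ O) ∧ ∀ Y ∈ 𝓝 y,
      dimH ((fun y k => meanAt c β j (a, b k) y) '' Y) = e := by
  obtain ⟨b, hb⟩ := exists_forall_eq_zero_of_separating
    (fun b : O => (fderiv ℝ (meanAt c β j (a, b)) y : (Fin e → ℝ) →ₗ[ℝ] ℝ)) fun v hv =>
      eq_zero_of_fderiv_meanAt_eq_zero he he0 h1 h2 hβ hli hy ha hO hne hOpos v
        fun b hb => hv ⟨b, hb⟩
  refine ⟨fun k => b k, fun k => (b k).2, fun Y hY => ?_⟩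
  have hstrict : HasStrictFDerivAt (fun y k => meanAt c β j (a, b k) y)
      (ContinuousLinearMap.pi fun k => fderiv ℝ (meanAt c β j (a, b k)) y) y :=
    hasStrictFDerivAt_pi.2 fun k =>
      (contDiffAt_meanAt h1 h2 hβ hy ha (hOpos _ (b k).2)).hasStrictFDerivAt one_ne_zero
  have hinj : Function.Injective ((ContinuousLinearMap.pi fun k =>
      fderiv ℝ (meanAt c β j (a, b k)) y : (Fin e → ℝ) →L[ℝ] (Fin e → ℝ)) :
        (Fin e → ℝ) →ₗ[ℝ] (Fin e → ℝ)) := by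
    rw [injective_iff_map_eq_zero]
    exact fun v hv => hb v fun k => congrFun hv k
  have hsurj := LinearMap.range_eq_top.2 (LinearMap.injective_iff_surjective.1 hinj)
  have hmap := hstrict.map_nhds_eq_of_surj hsurj
  have := Filter.image_mem_map (m := fun y k => meanAt c β j (a, b k) y) hY
  rw [hmap] at this
  rw [Real.dimH_of_mem_nhds this]
  simp

end

/-! ### What the output of a program depends on -/

variable {s : ℕ}

/-- The vector `μ` with the coordinates outside `R` replaced by `0`. -/
def mask (R : Finset (Fin s)) (μ : Fin s → ℝ) : Fin s → ℝ :=
  fun r => if r ∈ R then μ r else 0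

/-- The map `μ` may be arbitrary: the image lies in a coordinate subspace of dimension `R.card`. -/
theorem dimH_mask_image_le (R : Finset (Fin s)) {X : Type*} (μ : X → Fin s → ℝ) (V : Set X) :
    dimH ((fun x => mask R (μ x)) '' V) ≤ R.card := by
  have hL : LipschitzWith 1 fun (w : R → ℝ) (r : Fin s) => if h : r ∈ R then w ⟨r, h⟩ else 0 := by
    refine LipschitzWith.of_edist_le fun w w' => ?_
    rw [edist_pi_le_iff]
    intro r
    by_cases h : r ∈ R
    · simpa [h] using edist_le_pi_edist w w' ⟨r, h⟩
    · simp [h]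
  calc dimH ((fun x => mask R (μ x)) '' V)
      ≤ dimH (Set.range fun (w : R → ℝ) (r : Fin s) => if h : r ∈ R then w ⟨r, h⟩ else 0) := by
        refine dimH_mono ?_
        rintro _ ⟨x, -, rfl⟩
        exact ⟨fun r => μ x r, funext fun r => by simp [mask]⟩
    _ ≤ dimH (Set.univ : Set (R → ℝ)) := hL.dimH_range_le
    _ = R.card := by rw [Real.dimH_univ_pi, Fintype.card_coe]

theorem lipschitzWith_snd_apply {α : Type*} [PseudoEMetricSpace α] (r : Fin s) :
    LipschitzWith 1 fun p : α × (Fin s → ℝ) => p.2 r := by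
  have h := (LipschitzWith.eval (α := fun _ : Fin s => ℝ) r).comp (LipschitzWith.prod_snd (α := α))
  rw [mul_one] at h
  exact h

namespace Operand

/-- The memory cells that an operand reads: one or none. -/
def cells : Operand n s → Finset (Fin s)
  | mem r => {r}
  | alpha => ∅
  | beta _ => ∅

theorem card_cells_le (a : Operand n s) : a.cells.card ≤ 1 := by
  cases a <;> simp [cells]

theorem value_mask {a : Operand n s} {R : Finset (Fin s)} (h : a.cells ⊆ R) (c : CauseData n)
    (μ : Fin s → ℝ) : a.value c (mask R μ) = a.value c μ := by
  cases a with
  | mem r =>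
    have : r ∈ R := h (by simp [cells])
    simp [value, mask, this]
  | alpha => rfl
  | beta i => rfl

theorem lipschitzWith_value (a : Operand n s) :
    LipschitzWith 1 fun p : CauseData n × (Fin s → ℝ) => a.value p.1 p.2 := by
  cases a with
  | mem r => exact lipschitzWith_snd_apply r
  | alpha =>
    have h := (LipschitzWith.prod_fst (α := ℝ) (β := Fin n → ℝ)).comp
      (LipschitzWith.prod_fst (α := CauseData n) (β := Fin s → ℝ))
    rw [mul_one] at h
    exact h
  | beta i =>
    have h := ((LipschitzWith.eval (α := fun _ : Fin n => ℝ) i).comp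
      (LipschitzWith.prod_snd (α := ℝ))).comp
      (LipschitzWith.prod_fst (α := CauseData n) (β := Fin s → ℝ))
    rw [mul_one, mul_one] at h
    exact h

theorem continuousOn_value {X : Type*} [TopologicalSpace X] (a : Operand n s) {U : Set X}
    {c : X → CauseData n} {μ : X → Fin s → ℝ} (hc : ContinuousOn c U) (hμ : ContinuousOn μ U) :
    ContinuousOn (fun x => a.value (c x) (μ x)) U :=
  a.lipschitzWith_value.continuous.comp_continuousOn (hc.prodMk hμ)

end Operand

namespace Program

/-- On `V`, the last output of `P` is either absent or a locally Lipschitz function of the current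
cause and of the memory cells in `R`. -/
def OutputFactors {X : Type*} (P : Program n s) (c : X → CauseData n) (μ : X → Fin s → ℝ)
    (V : Set X) (R : Finset (Fin s)) : Prop :=
  (∀ x ∈ V, P.outputs (c x) (μ x) = []) ∨
    ∃ g : CauseData n × (Fin s → ℝ) → ℝ,
      LocallyLipschitzOn ((fun x => (c x, mask R (μ x))) '' V) g ∧
      ∀ x ∈ V, (P.outputs (c x) (μ x)).getLast? = some (g (c x, mask R (μ x)))

theorem OutputFactors.mono {X : Type*} {P : Program n s} {c : X → CauseData n}
    {μ : X → Fin s → ℝ} {V : Set X} {R R' : Finset (Fin s)} (h : P.OutputFactors c μ V R)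
    (hR : R ⊆ R') : P.OutputFactors c μ V R' := by
  refine h.imp id ?_
  rintro ⟨g, hg, hout⟩
  have hmask : ∀ μ : Fin s → ℝ, mask R (mask R' μ) = mask R μ := fun μ => by
    funext r
    by_cases h : r ∈ R
    · simp [mask, h, hR h]
    · simp [mask, h]
  refine ⟨fun p => g (p.1, mask R p.2), ?_, fun x hx => by simp only [hout x hx, hmask]⟩
  refine hg.comp' (LocallyLipschitzOn.prodMk' LipschitzWith.prod_fst.locallyLipschitz.locallyLipschitzOn
    (locallyLipschitzOn_pi fun r => ?_)) ?_
  · by_cases h : r ∈ R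
    · simpa [mask, h] using
        (lipschitzWith_snd_apply r).locallyLipschitz.locallyLipschitzOn
    · simpa [mask, h] using (LipschitzWith.const (0 : ℝ)).locallyLipschitz.locallyLipschitzOn
  · rintro _ ⟨x, hx, rfl⟩
    exact ⟨x, hx, by simp only [hmask]⟩

/-- Dependencies are traced backwards: the old content of the overwritten cell `t` is no longer
needed unless it is an argument, and the cells among the arguments are added. -/
theorem outputFactors_assign {X : Type*} {t : Fin s} {k : ℕ} {args : Fin k → Operand n s}
    {dom : Set (Fin k → ℝ)} {f : (Fin k → ℝ) → ℝ} {hf : LocallyLipschitzOn dom f}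
    {next : Program n s} {c : X → CauseData n} {μ : X → Fin s → ℝ} {V : Set X}
    {R : Finset (Fin s)} (hdom : ∀ x ∈ V, (fun l => (args l).value (c x) (μ x)) ∈ dom)
    (h : next.OutputFactors c
      (fun x => Function.update (μ x) t (f fun l => (args l).value (c x) (μ x))) V R) :
    (assign t k args dom f hf next).OutputFactors c μ V
      (R.erase t ∪ Finset.univ.biUnion fun l => (args l).cells) := by
  set R' := R.erase t ∪ Finset.univ.biUnion fun l => (args l).cells with hR'
  have hargs : ∀ l, (args l).cells ⊆ R' := fun l =>
    (Finset.subset_biUnion_of_mem (fun l => (args l).cells) (Finset.mem_univ l)).trans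
      Finset.subset_union_right
  refine h.imp id ?_
  rintro ⟨g, hg, hout⟩
  set ψ : CauseData n × (Fin s → ℝ) → ℝ := fun p => f fun l => (args l).value p.1 p.2 with hψ
  have hψval : ∀ x, ψ (c x, mask R' (μ x)) = f fun l => (args l).value (c x) (μ x) := fun x => by
    simp only [hψ, Operand.value_mask (hargs _)]
  have hstep : ∀ x, mask R (Function.update (mask R' (μ x)) t (ψ (c x, mask R' (μ x)))) =
      mask R (Function.update (μ x) t (f fun l => (args l).value (c x) (μ x))) := fun x => by
    rw [hψval]
    funext r
    by_cases hr : r ∈ R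
    · by_cases hrt : r = t
      · subst hrt; simp [mask]
      · have : r ∈ R' := Finset.mem_union_left _ (Finset.mem_erase.2 ⟨hrt, hr⟩)
        simp [mask, hr, hrt, this]
    · simp [mask, hr]
  refine ⟨fun p => g (p.1, mask R (Function.update p.2 t (ψ p))), ?_, fun x hx => by
    simp only [hstep]; exact hout x hx⟩
  refine hg.comp' (LocallyLipschitzOn.prodMk'
    LipschitzWith.prod_fst.locallyLipschitz.locallyLipschitzOn
    (locallyLipschitzOn_pi fun r => ?_)) ?_
  · by_cases hr : r ∈ R
    · by_cases hrt : r = t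
      · subst hrt
        simp only [mask, hr, if_true, Function.update_self]
        refine hf.comp' (locallyLipschitzOn_pi fun l =>
          (args l).lipschitzWith_value.locallyLipschitz.locallyLipschitzOn) ?_
        rintro _ ⟨x, hx, rfl⟩
        simpa only [Operand.value_mask (hargs _)] using hdom x hx
      · simpa [mask, hr, hrt] using
          (lipschitzWith_snd_apply r).locallyLipschitz.locallyLipschitzOn
    · simpa [mask, hr] using (LipschitzWith.const (0 : ℝ)).locallyLipschitz.locallyLipschitzOn
  · rintro _ ⟨x, hx, rfl⟩
    exact ⟨x, hx, by simp only [hstep]⟩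

theorem OutputFactors.congr_outputs {X : Type*} {P Q : Program n s} {c : X → CauseData n}
    {μ : X → Fin s → ℝ} {V : Set X} {R : Finset (Fin s)} (h : P.OutputFactors c μ V R)
    (hPQ : ∀ x ∈ V, Q.outputs (c x) (μ x) = P.outputs (c x) (μ x)) : Q.OutputFactors c μ V R := by
  refine h.imp (fun h x hx => (hPQ x hx).trans (h x hx)) ?_
  rintro ⟨g, hg, hout⟩
  exact ⟨g, hg, fun x hx => by rw [hPQ x hx, hout x hx]⟩

/-- The execution of a program follows a fixed path on some nonempty open subset of any open set
of data. There the final memory is continuous, and the last output is a locally Lipschitz function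
of at most as many memory cells as the running time. -/
theorem exists_open_outputFactors {X : Type*} [TopologicalSpace X] (c : X → CauseData n)
    (P : Program n s) : ∀ (U : Set X) (μ : X → Fin s → ℝ), IsOpen U → U.Nonempty →
    ContinuousOn c U → ContinuousOn μ U → (∀ x ∈ U, P.Safe (c x) (μ x)) →
    ∃ V ⊆ U, IsOpen V ∧ V.Nonempty ∧ ContinuousOn (fun x => P.finalMem (c x) (μ x)) V ∧
      ∃ R : Finset (Fin s), (∀ x ∈ V, R.card ≤ P.time (c x) (μ x)) ∧ P.OutputFactors c μ V R := by
  induction P with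
  | halt =>
    intro U μ hU hne hc hμ _
    exact ⟨U, subset_rfl, hU, hne, hμ, ∅, fun _ _ => by simp, Or.inl fun _ _ => rfl⟩
  | assign t k args dom f hf next ih =>
    intro U μ hU hne hc hμ hsafe
    have hval : ContinuousOn (fun x => f fun l => (args l).value (c x) (μ x)) U :=
      hf.continuousOn.comp (continuousOn_pi.2 fun l => (args l).continuousOn_value hc hμ)
        fun x hx => (hsafe x hx).1
    obtain ⟨V, hVU, hV, hVne, hfin, R, htime, hout⟩ := ih U
      (fun x => Function.update (μ x) t (f fun l => (args l).value (c x) (μ x))) hU hne hc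
      (fun x hx => (hμ x hx).update t (hval x hx)) fun x hx => (hsafe x hx).2
    refine ⟨V, hVU, hV, hVne, hfin, _, fun x hx => ?_,
      outputFactors_assign (fun x hx => (hsafe x (hVU hx)).1) hout⟩
    have h1 : (Finset.univ.biUnion fun l => (args l).cells).card ≤ k := by
      simpa using Finset.card_biUnion_le_card_mul (Finset.univ : Finset (Fin k))
        (fun l => (args l).cells) 1 fun l _ => (args l).card_cells_le
    have h2 := htime x hx
    have h3 := Finset.card_union_le (R.erase t) (Finset.univ.biUnion fun l => (args l).cells)
    have h4 := Finset.card_erase_le (s := R) (a := t)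
    simp only [time]
    have h5 := le_max_right 1 k
    omega
  | branch a p q ihp ihq =>
    intro U μ hU hne hc hμ hsafe
    have ha := a.continuousOn_value hc hμ
    have hcard := fun R : Finset (Fin s) => Finset.card_union_le a.cells R
    have hcells := a.card_cells_le
    -- If the tested number is positive somewhere, then it is so on a nonempty open subset;
    -- otherwise the other branch is taken on all of `U`.
    by_cases hpos : ∃ x ∈ U, ¬ a.value (c x) (μ x) ≤ 0
    · obtain ⟨x₀, hx₀, hx₀'⟩ := hpos
      have hsub : U ∩ (fun x => a.value (c x) (μ x)) ⁻¹' Set.Ioi 0 ⊆ U := Set.inter_subset_left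
      obtain ⟨V, hVU, hV, hVne, hfin, R, htime, hout⟩ := ihq _ μ
        (ha.isOpen_inter_preimage hU isOpen_Ioi) ⟨x₀, hx₀, not_le.1 hx₀'⟩ (hc.mono hsub)
        (hμ.mono hsub) fun x hx => (hsafe x hx.1).2 (not_le.2 hx.2)
      have hneg : ∀ x ∈ V, ¬ a.value (c x) (μ x) ≤ 0 := fun x hx => not_le.2 (hVU hx).2
      refine ⟨V, hVU.trans hsub, hV, hVne, hfin.congr fun x hx => by simp [finalMem, hneg x hx],
        a.cells ∪ R, fun x hx => ?_, (hout.mono Finset.subset_union_right).congr_outputs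
          fun x hx => by simp [outputs, hneg x hx]⟩
      have h1 := hcard R
      have h2 := htime x hx
      simp only [time, if_neg (hneg x hx)]
      omega
    · push Not at hpos
      obtain ⟨V, hVU, hV, hVne, hfin, R, htime, hout⟩ := ihp U μ hU hne hc hμ
        fun x hx => (hsafe x hx).1 (hpos x hx)
      have hle : ∀ x ∈ V, a.value (c x) (μ x) ≤ 0 := fun x hx => hpos x (hVU hx)
      refine ⟨V, hVU, hV, hVne, hfin.congr fun x hx => by simp [finalMem, hle x hx],
        a.cells ∪ R, fun x hx => ?_, (hout.mono Finset.subset_union_right).congr_outputs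
          fun x hx => by simp [outputs, hle x hx]⟩
      have h1 := hcard R
      have h2 := htime x hx
      simp only [time, if_pos (hle x hx)]
      omega
  | emit a next ih =>
    intro U μ hU hne hc hμ hsafe
    obtain ⟨V, hVU, hV, hVne, hfin, R, htime, hout⟩ := ih U μ hU hne hc hμ hsafe
    refine ⟨V, hVU, hV, hVne, hfin, a.cells ∪ R, fun x hx => ?_, Or.inr ?_⟩
    · have h1 := Finset.card_union_le a.cells R
      have h2 := htime x hx
      have h3 := a.card_cells_le
      simp only [time]
      omega
    · rcases hout.mono (Finset.subset_union_right (s₁ := a.cells)) with hnil | ⟨g, hg, hout⟩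
      · refine ⟨fun p => a.value p.1 p.2,
          a.lipschitzWith_value.locallyLipschitz.locallyLipschitzOn, fun x hx => ?_⟩
        simp only [Operand.value_mask Finset.subset_union_left, outputs, hnil x hx]
        rfl
      · refine ⟨g, hg, fun x hx => ?_⟩
        rw [outputs, List.getLast?_cons, hout x hx]
        rfl

end Program

theorem Program.OutputFactors.mono_set {X : Type*} {P : Program n s} {c : X → CauseData n}
    {μ : X → Fin s → ℝ} {V V' : Set X} {R : Finset (Fin s)} (h : P.OutputFactors c μ V R)
    (hV : V' ⊆ V) : P.OutputFactors c μ V' R := by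
  refine h.imp (fun h x hx => h x (hV hx)) ?_
  rintro ⟨g, hg, hout⟩
  exact ⟨g, hg.mono (Set.image_mono hV), fun x hx => hout x (hV hx)⟩

/-! ### A box of data with a fixed course of execution -/

theorem OnePassAlgorithm.memory_congr (A : OnePassAlgorithm n s) {c c' : ℕ → CauseData n} :
    ∀ {j : ℕ}, (∀ z < j, c z = c' z) → A.memory c j = A.memory c' j
  | 0, _ => rfl
  | j + 1, h => by
    rw [memory, memory, A.memory_congr fun z hz => h z (hz.trans j.lt_succ_self),
      h j j.lt_succ_self]

theorem lastCauseMean_congr {c c' : ℕ → CauseData n} {j : ℕ} (h : ∀ z ≤ j, c z = c' z) :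
    lastCauseMean c j = lastCauseMean c' j := by
  have h' : ∀ z : Fin (j + 1), c z = c' z := fun z => h z (Nat.lt_succ_iff.1 z.2)
  simp only [lastCauseMean, h']

/-- Data of a cause that stay admissible under small changes. -/
def interiorData (n : ℕ) : Set (CauseData n) :=
  {d | 0 < d.1 ∧ (∀ i, 0 < d.2 i) ∧ ∑ i, d.2 i < 1}

theorem isOpen_interiorData (n : ℕ) : IsOpen (interiorData n) := by
  have : interiorData n = {d | 0 < d.1} ∩ ((⋂ i, {d | 0 < d.2 i}) ∩ {d | ∑ i, d.2 i < 1}) := by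
    ext d; simp [interiorData]
  rw [this]
  exact (isOpen_lt continuous_const continuous_fst).inter
    ((isOpen_iInter_of_finite fun i => isOpen_lt continuous_const (by fun_prop)).inter
      (isOpen_lt (by fun_prop) continuous_const))

theorem valid_of_mem_interiorData {d : CauseData n} (h : d ∈ interiorData n) : d.Valid :=
  ⟨h.1, h.2.1, h.2.2.le⟩

theorem uniform_mem_interiorData (n : ℕ) :
    ((1, fun _ => 1 / (n + 1)) : CauseData n) ∈ interiorData n := by
  have h : (0 : ℝ) < n + 1 := by positivity
  refine ⟨one_pos, fun i => by positivity, ?_⟩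
  simp only [Finset.sum_const, Finset.card_univ, Fintype.card_fin, nsmul_eq_mul, mul_one_div]
  rw [div_lt_one h]
  linarith

/-- Data of `m` causes, continued by an arbitrary fixed cause. -/
noncomputable def extendData {m : ℕ} (x : Fin m → CauseData n) : ℕ → CauseData n :=
  fun z => if h : z < m then x ⟨z, h⟩ else (1, fun _ => 1 / (n + 1))

theorem continuous_extendData {m : ℕ} (z : ℕ) :
    Continuous fun x : Fin m → CauseData n => extendData x z := by
  unfold extendData
  split_ifs
  · exact continuous_apply _
  · exact continuous_const

theorem extendData_valid {m : ℕ} {x : Fin m → CauseData n} (hx : ∀ z, x z ∈ interiorData n)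
    (z : ℕ) : (extendData x z).Valid := by
  unfold extendData
  split_ifs
  · exact valid_of_mem_interiorData (hx _)
  · exact valid_of_mem_interiorData (uniform_mem_interiorData n)

/-- The open set shrinks with each cause. Continuity of the memory on it is what allows the next
program to be treated. -/
theorem exists_open_forall_outputFactors {m : ℕ} (A : OnePassAlgorithm n s)
    (hA : A.ComputesPosteriorMean m) : ∀ J ≤ m, ∃ V : Set (Fin m → CauseData n), IsOpen V ∧
      V.Nonempty ∧ (∀ x ∈ V, ∀ z, x z ∈ interiorData n) ∧
      ContinuousOn (fun x => A.memory (extendData x) J) V ∧ ∀ j < J, ∃ R : Finset (Fin s),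
        (∀ x ∈ V, R.card ≤ (A.program j).time (extendData x j) (A.memory (extendData x) j)) ∧
        (A.program j).OutputFactors (fun x => extendData x j)
          (fun x => A.memory (extendData x) j) V R
  | 0, _ => by
    refine ⟨{x | ∀ z, x z ∈ interiorData n}, ?_, ⟨_, fun _ => uniform_mem_interiorData n⟩,
      fun x hx => hx, continuousOn_const, fun j hj => absurd hj j.not_lt_zero⟩
    have : {x : Fin m → CauseData n | ∀ z, x z ∈ interiorData n} =
        ⋂ z, (fun x => x z) ⁻¹' interiorData n := by ext x; simp
    rw [this]
    exact isOpen_iInter_of_finite fun z => (isOpen_interiorData n).preimage (continuous_apply z)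
  | J + 1, hJ => by
    obtain ⟨U, hU, hne, hint, hmem, hall⟩ :=
      exists_open_forall_outputFactors A hA J (Nat.le_of_succ_le hJ)
    obtain ⟨V, hVU, hV, hVne, hfin, R, htime, hout⟩ := Program.exists_open_outputFactors
      (fun x => extendData x J) (A.program J) U (fun x => A.memory (extendData x) J) hU hne
      (continuous_extendData J).continuousOn hmem
      fun x hx => (hA _ (extendData_valid (hint x hx)) J hJ).1
    refine ⟨V, hV, hVne, fun x hx => hint x (hVU hx), hfin, fun j hj => ?_⟩
    rcases Nat.lt_succ_iff_lt_or_eq.1 hj with hj | rfl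
    · obtain ⟨R', h1, h2⟩ := hall j hj
      exact ⟨R', fun x hx => h1 x (hVU hx), h2.mono_set hVU⟩
    · exact ⟨R, htime, hout⟩

/-- The data sequences that are uniformly close to `c₀`. -/
def dataBox (c₀ : ℕ → CauseData n) (ε : ℝ) : Set (ℕ → CauseData n) :=
  {c | ∀ z, dist (c z) (c₀ z) < ε}

theorem exists_dataBox {m : ℕ} (A : OnePassAlgorithm n s) (hA : A.ComputesPosteriorMean m) :
    ∃ (c₀ : ℕ → CauseData n) (ε : ℝ), 0 < ε ∧ (∀ c ∈ dataBox c₀ ε, ∀ z, (c z).Valid) ∧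
      ∀ j < m, ∃ R : Finset (Fin s),
        (∀ c ∈ dataBox c₀ ε, R.card ≤ (A.program j).time (c j) (A.memory c j)) ∧
        ∃ g : CauseData n × (Fin s → ℝ) → ℝ,
          LocallyLipschitzOn ((fun c => (c j, mask R (A.memory c j))) '' dataBox c₀ ε) g ∧
          ∀ c ∈ dataBox c₀ ε, lastCauseMean c j = g (c j, mask R (A.memory c j)) := by
  obtain ⟨V, hV, ⟨x₀, hx₀⟩, hint, -, hall⟩ := exists_open_forall_outputFactors A hA m le_rfl
  obtain ⟨ε₁, hε₁, hb₁⟩ := Metric.isOpen_iff.1 hV x₀ hx₀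
  -- The first radius controls the first `m` causes, the second keeps all later causes admissible.
  obtain ⟨ε₂, hε₂, hb₂⟩ :=
    Metric.isOpen_iff.1 (isOpen_interiorData n) _ (uniform_mem_interiorData n)
  have hrestr : ∀ c ∈ dataBox (extendData x₀) (min ε₁ ε₂), (fun z : Fin m => c z) ∈ V :=
    fun c hc => hb₁ <| by
      rw [Metric.mem_ball, dist_pi_lt_iff hε₁]
      intro z
      have := (hc z).trans_le (min_le_left _ _)
      rwa [extendData, dif_pos z.2] at this
  have heq : ∀ (c : ℕ → CauseData n), ∀ z < m, extendData (fun z : Fin m => c z) z = c z :=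
    fun c z hz => dif_pos hz
  refine ⟨extendData x₀, min ε₁ ε₂, lt_min hε₁ hε₂, fun c hc z => ?_, fun j hj => ?_⟩
  · by_cases hz : z < m
    · exact valid_of_mem_interiorData (hint _ (hrestr c hc) ⟨z, hz⟩)
    · have := (hc z).trans_le (min_le_right _ _)
      rw [extendData, dif_neg hz] at this
      exact valid_of_mem_interiorData (hb₂ this)
  · obtain ⟨R, htime, hout⟩ := hall j hj
    have hmemory : ∀ c, A.memory (extendData fun z : Fin m => c z) j = A.memory c j := fun c =>
      A.memory_congr fun z hz => heq c z (hz.trans hj)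
    refine ⟨R, fun c hc => ?_, ?_⟩
    · simpa only [heq c j hj, hmemory] using htime _ (hrestr c hc)
    have hlast : ∀ c ∈ dataBox (extendData x₀) (min ε₁ ε₂),
        ((A.program j).outputs (c j) (A.memory c j)).getLast? = some (lastCauseMean c j) :=
      fun c hc => by
        have := (hA _ (extendData_valid (hint _ (hrestr c hc))) j hj).2
        rwa [heq c j hj, hmemory, lastCauseMean_congr
          fun z hz => heq c z (hz.trans_lt hj)] at this
    rcases hout with hnil | ⟨g, hg, hout⟩
    · have h1 := hnil x₀ hx₀
      have h2 := (hA _ (extendData_valid (hint _ hx₀)) j hj).2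
      rw [h1] at h2
      exact absurd h2 (by simp)
    · refine ⟨g, hg.mono ?_, fun c hc => ?_⟩
      · rintro _ ⟨c, hc, rfl⟩
        exact ⟨_, hrestr c hc, by simp only [heq c j hj, hmemory]⟩
      · have h1 := hout _ (hrestr c hc)
        simp only [heq c j hj, hmemory] at h1
        exact Option.some_injective _ ((hlast c hc).symm.trans h1)

/-! ### Comparison of dimensions and the lower bounds -/

/-- If the posterior mean of cause `j` is a locally Lipschitz function of the data of this cause
and of the memory cells in `R`, then `R` has at least `min j (2 ^ n)` elements. -/
theorem le_card_of_factors (A : OnePassAlgorithm n s) {c₀ : ℕ → CauseData n} {ε : ℝ}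
    (hε : 0 < ε) (hvalid : ∀ c ∈ dataBox c₀ ε, ∀ z, (c z).Valid) {j : ℕ} {R : Finset (Fin s)}
    {g : CauseData n × (Fin s → ℝ) → ℝ}
    (hg : LocallyLipschitzOn ((fun c => (c j, mask R (A.memory c j))) '' dataBox c₀ ε) g)
    (hmean : ∀ c ∈ dataBox c₀ ε, lastCauseMean c j = g (c j, mask R (A.memory c j)))
    {e : ℕ} (hej : e ≤ j) (hen : e ≤ 2 ^ n) : e ≤ R.card := by
  rcases Nat.eq_zero_or_pos e with rfl | he0
  · exact Nat.zero_le _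
  have hself : c₀ ∈ dataBox c₀ ε := fun z => by rwa [dist_self]
  have hupd : ∀ c ∈ dataBox c₀ ε, ∀ (z : ℕ) (d : CauseData n), dist d (c₀ z) < ε →
      Function.update c z d ∈ dataBox c₀ ε := fun c hc z d hd y => by
    by_cases h : y = z
    · subst h; rwa [Function.update_self]
    · rw [Function.update_of_ne h]; exact hc y
  have hpos2 : ∀ (z : ℕ), ∀ b ∈ Metric.ball (c₀ z).2 ε,
      dist (((c₀ z).1, b) : CauseData n) (c₀ z) < ε := fun z b hb => by
    rw [Prod.dist_eq]; exact max_lt (by rwa [dist_self]) hb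
  have hpos3 : ∀ (z : ℕ), ∀ b ∈ Metric.ball (c₀ z).2 ε, ∀ i, 0 < b i := fun z b hb => by
    have := (hvalid _ (hupd c₀ hself z _ (hpos2 z b hb)) z).2.1
    rwa [Function.update_self] at this
  have h1 : ∀ z, 0 < (c₀ z).1 := fun z => (hvalid c₀ hself z).1
  have h2 : ∀ z i, 0 < (c₀ z).2 i := fun z => (hvalid c₀ hself z).2.1
  obtain ⟨β, hβ, hli⟩ := exists_linearIndependent_monomials e hen
    (fun z => Metric.ball (c₀ z).2 ε) (fun z => Metric.isOpen_ball)
    fun z => ⟨_, Metric.mem_ball_self hε⟩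
  have hβpos : ∀ z i, 0 < β z i := fun z => hpos3 z _ (hβ z)
  obtain ⟨b, hb, hdim⟩ := exists_dimH_image_meanAt hej he0 h1 h2 hβpos hli
    (y := fun z => (c₀ z).1) (fun z => h1 z) (h1 j) (O := Metric.ball (c₀ j).2 ε)
    Metric.isOpen_ball ⟨_, Metric.mem_ball_self hε⟩ (hpos3 j)
  set y₀ : Fin e → ℝ := fun z => (c₀ z).1
  have hball : ∀ y ∈ Metric.ball y₀ ε, replaceCauses c₀ β y ∈ dataBox c₀ ε := fun y hy =>
    forall_replaceCauses (p := fun z d => dist d (c₀ z) < ε) (fun z => by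
      rw [Prod.dist_eq]
      exact max_lt (((dist_pi_lt_iff hε).1 (Metric.mem_ball.1 hy)) z) (hβ z)) hself
  have hbox : ∀ y ∈ Metric.ball y₀ ε, ∀ k,
      Function.update (replaceCauses c₀ β y) j ((c₀ j).1, b k) ∈ dataBox c₀ ε := fun y hy k =>
    hupd _ (hball y hy) _ _ (hpos2 j _ (hb k))
  -- The memory is fixed before cause `j` is read, so the same content has to serve all `e` values
  -- `b k`.
  have hmem : ∀ y d, A.memory (Function.update (replaceCauses c₀ β y) j d) j =
      A.memory (replaceCauses c₀ β y) j := fun y d =>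
    A.memory_congr fun z hz => Function.update_of_ne hz.ne _ _
  have hF : ∀ y ∈ Metric.ball y₀ ε, ∀ k, meanAt c₀ β j ((c₀ j).1, b k) y =
      g (((c₀ j).1, b k), mask R (A.memory (replaceCauses c₀ β y) j)) := fun y hy k => by
    have hC := hbox y hy k
    have := hmean _ hC
    rw [lastCauseMean_eq (fun z => (hvalid _ hC z).1) (fun z => (hvalid _ hC z).2.1), hmem,
      Function.update_self] at this
    rw [← this, meanAt, meanOfWeights,
      assignmentWeight_congr (c := Function.update (replaceCauses c₀ β y) j ((c₀ j).1, b k))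
        (c' := replaceCauses c₀ β y) fun z hz => Function.update_of_ne hz.ne _ _]
    congr 4
    exact Finset.sum_congr rfl fun z hz => by
      rw [Function.update_of_ne (Finset.mem_range.1 hz).ne]
  set T := (fun y => mask R (A.memory (replaceCauses c₀ β y) j)) '' Metric.ball y₀ ε
  set H : (Fin s → ℝ) → Fin e → ℝ := fun v k => g (((c₀ j).1, b k), v)
  have himage : (fun y k => meanAt c₀ β j ((c₀ j).1, b k) y) '' Metric.ball y₀ ε = H '' T := by
    rw [Set.image_image]
    exact Set.image_congr fun y hy => funext fun k => hF y hy k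
  have hH : LocallyLipschitzOn T H := by
    refine locallyLipschitzOn_pi fun k => hg.comp' (LocallyLipschitzOn.prodMk'
      (LipschitzWith.const _).locallyLipschitz.locallyLipschitzOn
      LipschitzWith.id.locallyLipschitz.locallyLipschitzOn) ?_
    rintro _ ⟨y, hy, rfl⟩
    exact ⟨_, hbox y hy k, by simp only [hmem, Function.update_self]⟩
  -- The image has dimension `e`, but it is also the locally Lipschitz image under `H` of the set
  -- `T` of masked memories, whose dimension is at most `R.card`.
  have hle : (e : ENNReal) ≤ R.card := by
    rw [← hdim _ (Metric.ball_mem_nhds y₀ hε), himage]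
    exact (dimH_image_le_of_locally_lipschitzOn fun x hx => hH hx).trans
      (dimH_mask_image_le R _ _)
  exact_mod_cast hle

/-- There is equality for `m = d + 1`, and each further term adds `2 * d` on the right but only `d`
on the left. -/
theorem mul_le_two_mul_sum_min {d m : ℕ} (h : d + 1 ≤ m) :
    m * d ≤ 2 * ∑ j ∈ Finset.range m, min j d := by
  induction m, h using Nat.le_induction with
  | base =>
    rw [Finset.sum_congr rfl fun j hj => min_eq_left (Nat.lt_succ_iff.1 (Finset.mem_range.1 hj)),
      mul_comm 2, Finset.sum_range_id_mul_two]
    rfl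
  | succ m hm ih =>
    rw [Finset.sum_range_succ, min_eq_right (by omega)]
    linarith

end LDA

theorem theorem2 (n m s : ℕ) (hm : 2 ^ n ≤ m) (A : LDA.OnePassAlgorithm n s)
    (hA : A.ComputesPosteriorMean m) :
    2 ^ n - 1 ≤ s ∧
      ∃ c : ℕ → LDA.CauseData n, (∀ j, (c j).Valid) ∧
        m * (2 ^ n - 1) ≤ 2 * A.time c m := by
  have hpow : 1 ≤ 2 ^ n := Nat.one_le_two_pow
  obtain ⟨c, ε, hε, hvalid, hall⟩ := LDA.exists_dataBox A hA
  have hself : c ∈ LDA.dataBox c ε := fun z => by rwa [dist_self]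
  refine ⟨?_, c, hvalid c hself, ?_⟩
  · obtain ⟨R, -, g, hg, hmean⟩ := hall (m - 1) (by omega)
    exact (LDA.le_card_of_factors A hε hvalid hg hmean (by omega) (Nat.sub_le _ _)).trans
      (R.card_le_univ.trans_eq (Fintype.card_fin s))
  -- The centre of the box serves for all `j` at once, with `e = min j (2 ^ n - 1)`.
  · refine (LDA.mul_le_two_mul_sum_min (by omega)).trans (Nat.mul_le_mul_left 2 ?_)
    refine Finset.sum_le_sum fun j hj => ?_
    obtain ⟨R, htime, g, hg, hmean⟩ := hall j (Finset.mem_range.1 hj)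
    exact (LDA.le_card_of_factors A hε hvalid hg hmean (min_le_left _ _)
      ((min_le_right _ _).trans (Nat.sub_le _ _))).trans (htime c hself)
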